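/- Let $G$ and $H$ be countably infinite groups. For a group $K$ and a set $\alpha$, $K$ acts on $\alpha^K$ by $(k\cdot x)(l)=x(lk)$; a $K$-subshift is a non-empty closed $K$-invariant subset of $\alpha^K$. For $D\subseteq K$, sets $S,T\subseteq K$ are $D$-apart if $DS\cap DT=\emptyset$; $S$ is $D$-spaced if its distinct elements are pairwise $D$-apart. A subshift $X\subseteq\alpha^H$ is $D$-irreducible if for any $D$-apart $S_0,S_1\subseteq H$ and $x_0,x_1\in X$ some $y\in X$ satisfies $y|_{S_i}=x_i|_{S_i}$ ($i<2$); it is strongly irreducible if this holds for some finite $D$. For $C\subseteq H$ put $P_C(X)=\{x|_C:x\in X\}$. **Systems on $G$.** Let $G=\bigcup_nA_n$ be an exhaustion by finite symmetric sets containing $1_G$, with $A_n=A_0^3A_1^3\cdots A_{n-1}^3B_n$ for finite sets $B_n\ni1_G$. Put $A_n(k)=A_k^3\cdots A_{n-1}^3B_n$. A system of height $n$ is a collection $\mathcal S(0),\dots,\mathcal S(n)\subseteq A_n$ with $\mathcal S(n)=\{1_G\}$ and such that, for each $k<n$, $\mathcal S(k)$ contains $1_G$ and is a maximal $A_k$-spaced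 subset of the set of $g\in A_n$ with the following property: for the least $\ell>k$ with $A_kg\cap A_\ell\mathcal S(\ell)\neq\emptyset$ there is $h\in\mathcal S(\ell)$ with $A_kg\subseteq A_\ell(k)h$. For $g\in\mathcal S(m)$ put $(g\cdot\mathcal S)|_m(k)=(\mathcal S(k)\cap A_mg)g^{-1}$ ($k\le m$). The system is uniform if, for each $m\le n$, $(g\cdot\mathcal S)|_m$ is the same for all $g\in\mathcal S(m)$. A coherent sequence is a sequence of uniform systems $\mathcal S_n$ of height $n$ with $(1_G\cdot\mathcal S_n)|_m=\mathcal S_m$ for all $m\le n$ (its blueprint is the sequence of sets $\bigcup_{N\ge n}\mathcal S_N(n)$). Put $S_n(k)=\mathcal S_n(k)\setminus\bigcup_{k<m<n}A_m\mathcal S_n(m)$ for $k<n$. **Printing.** For finite $C,D\subseteq H$, a set $X\subseteq \alpha^H$, $N=|(DC)^{-1}(DC)|$ and $p\in P_C(X)$, let $\mathrm{Print}(X,p,N)$ be the set of $(x_0,\dots,x_{N-1})\in X^N$ for which there is $\gamma\colon H\to N$ such that each $\gamma^{-1}(i)$ is $DC$-spaced and $(h\cdot x_{\gamma(h)})|_C=p$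 for all $h\in H$. **The construction.** Let $H=\bigcup_nC_n$ be an exhaustion by finite symmetric sets containing $1_H$, and let $(\mathcal S_n)$ be a coherent sequence on $G$. For $z\in(2^A)^H$ and $g\in G$, let $g^{-1}z\in(2^{Ag})^H$ be given by $(g^{-1}z)(h)(ag)=z(h)(a)$. Put $Y_0=(2^{A_0})^H$ and $D_0=\{1_H\}$. Given $Y_0,\dots,Y_n$ and a finite symmetric $D_n\subseteq H$ such that $Y_0,\dots,Y_n$ are all $D_n$-irreducible, let $q=|(D_nC_n)^{-1}(D_nC_n)|$, suppose that $|S_{n+1}(n)|>q\cdot2^{|A_n\times C_n|}$, and choose for each pattern $p\in P_{C_n}(Y_n)$ a set $F_p=\{g^p_0,\dots,g^p_{q-1}\}\subseteq S_{n+1}(n)\setminus\{1_G\}$ of size $q$, the sets $F_p$ being pairwise disjoint. Let $F'=S_{n+1}(n)\setminus\bigcup_pF_p$, let $T=A_{n+1}\setminus\bigcup_{k\le n}A_kS_{n+1}(k)$, let $Q_p$ be the set of all $((g^p_0)^{-1}x_0,\dots,(g^p_{q-1})^{-1}x_{q-1})$ with $(x_0,\dots,x_{q-1})\in\mathrm{Print}(Y_n,p,q)$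 (formed with $D=D_n$, $C=C_n$), and set $$Y_{n+1}=(2^T)^H\times\prod_{g\in F'}g^{-1}Y_n\times\prod_{p}Q_p\times\prod_{k<n}\ \prod_{g\in S_{n+1}(k)}g^{-1}Y_k\ \subseteq(2^{A_{n+1}})^H.$$ Finally let $Y=\varprojlim Y_n=\{x\in2^{G\times H}:x|_{A_n\times H}\in Y_n\text{ for all }n\}$ and $X=\overline{G\cdot Y}\subseteq2^{G\times H}$. **Proposition.** For every exhaustion $(C_n)$ of $H$ as above, the choices in the construction can be made. For all such choices, each $Y_n$ is a strongly irreducible $H$-subshift, $Y_n|_{A_m\times H}=Y_m$ for $m\le n$, and $X$ is a $(G\times H)$-subshift. $X$ is essentially free as an $H$-flow (for each $h\ne1_H$ the set $\{x\in X:hx=x\}$ is nowhere dense in $X$), hence free as an $H$-flow, and it is minimal as a $G$-flow. Consequently $H$, acting on $X$, embeds into the centralizer of the minimal $G$-flow $X$, i.e. the group of homeomorphisms of $X$ that commute with the action of $G$. -/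

import Mathlib

open scoped Pointwise

/-! ### Shifts, flows and centralizers -/

/-- The full shift `α ^ K`, a type synonym of `K → α`. -/
def FullShift (K α : Type*) := K → α

namespace FullShift

/-- The product topology. -/
instance (K α : Type*) [TopologicalSpace α] : TopologicalSpace (FullShift K α) :=
  inferInstanceAs (TopologicalSpace (K → α))

/-- The group `K` acts on `α ^ K` by `(k • x) l = x (l * k)`. -/
instance (K α : Type*) [Group K] : MulAction K (FullShift K α) where
  smul k x := fun l => x (l * k)
  one_smul x := funext fun l => congrArg x (mul_one l)
  mul_smul k₁ k₂ x := funext fun l => congrArg x (mul_assoc l k₁ k₂).symm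

instance (K α : Type*) [Group K] [TopologicalSpace α] :
    ContinuousConstSMul K (FullShift K α) where
  continuous_const_smul k := continuous_pi fun l => continuous_apply (l * k)

end FullShift

/-- A subshift is a non-empty closed shift-invariant set of configurations. -/
def IsSubshift {K α : Type*} [Group K] [TopologicalSpace α] (X : Set (FullShift K α)) : Prop :=
  X.Nonempty ∧ IsClosed X ∧ ∀ k : K, ∀ x ∈ X, k • x ∈ X

/-- A `K`-flow: a compact Hausdorff space on which the (discrete) group `K` acts by
homeomorphisms. -/
def IsFlow (K X : Type*) [Group K] [TopologicalSpace X] [MulAction K X] : Prop :=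
  CompactSpace X ∧ T2Space X ∧ ContinuousConstSMul K X

/-- A minimal flow: a non-empty flow all of whose orbits are dense. -/
def IsMinimalFlow (K X : Type*) [Group K] [TopologicalSpace X] [MulAction K X] : Prop :=
  IsFlow K X ∧ Nonempty X ∧ ∀ x : X, Dense (MulAction.orbit K x)

/-- The flow is free: no non-trivial group element has a fixed point. -/
def IsFreeFlow (K X : Type*) [Group K] [TopologicalSpace X] [MulAction K X] : Prop :=
  IsFlow K X ∧ ∀ k : K, k ≠ 1 → ∀ x : X, k • x ≠ x

/-- The flow is essentially free: the fixed point set of every non-trivial group element is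
nowhere dense. -/
def IsEssentiallyFreeFlow (K X : Type*) [Group K] [TopologicalSpace X] [MulAction K X] : Prop :=
  IsFlow K X ∧ ∀ k : K, k ≠ 1 → IsNowhereDense {x : X | k • x = x}

/-- The centralizer of the `K`-flow `X`: the group of all homeomorphisms of `X` that commute with
the action of `K`. -/
def flowCentralizer (K X : Type*) [Group K] [TopologicalSpace X] [MulAction K X] :
    Subgroup (X ≃ₜ X) where
  carrier := {φ | ∀ (k : K) (x : X), φ (k • x) = k • φ x}
  one_mem' := fun _ _ => rfl
  mul_mem' := by
    intro φ ψ hφ hψ k x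
    change φ (ψ (k • x)) = k • φ (ψ x)
    rw [hψ, hφ]
  inv_mem' := by
    intro φ hφ k x
    change φ.symm (k • x) = k • φ.symm x
    rw [φ.symm_apply_eq, hφ, φ.apply_symm_apply]

/-- An exhaustion of a group by finite symmetric sets containing the identity. -/
structure IsExhaustion {K : Type*} [Group K] (A : ℕ → Set K) : Prop where
  mono : Monotone A
  iUnion_eq : ⋃ n, A n = Set.univ
  finite : ∀ n, (A n).Finite
  symm : ∀ n, (A n)⁻¹ = A n
  one_mem : ∀ n, (1 : K) ∈ A n

/-- `S` and `T` are `D`-apart. -/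
def IsApart {K : Type*} [Group K] (D S T : Set K) : Prop :=
  Disjoint (D * S) (D * T)

/-- `S` is `D`-spaced: any two distinct elements of `S` are `D`-apart. -/
def IsSpaced {K : Type*} [Group K] (D S : Set K) : Prop :=
  ∀ g ∈ S, ∀ h ∈ S, g ≠ h → IsApart D {g} {h}

/-! ### Systems and coherent sequences -/

section Systems

variable {G : Type*} [Group G]

/-- `A_n(k) = A_k ^ 3 ⋯ A_{n-1} ^ 3 * B_n`, for `k ≤ n`. -/
def innerBlock (A B : ℕ → Set G) (n k : ℕ) : Set G :=
  ((List.Ico k n).map fun i => A i ^ 3).prod * B n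

/-- The set `Ad(k, S)` of `k`-admissible elements for a collection `S(k+1), …, S(n)`: for the
least `l > k` such that `A_k g` meets `A_l S(l)`, some `h ∈ S(l)` has `A_k g ⊆ A_l(k) h`. -/
def admissible (A B : ℕ → Set G) (n : ℕ) (S : ℕ → Set G) (k : ℕ) : Set G :=
  {g | g ∈ A n ∧ ∃ l, k < l ∧ l ≤ n ∧ ((A k * {g}) ∩ (A l * S l)).Nonempty ∧
    (∀ m, k < m → m < l → (A k * {g}) ∩ (A m * S m) = ∅) ∧
    ∃ h ∈ S l, A k * {g} ⊆ innerBlock A B l k * {h}}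

/-- `S(0), …, S(n)` is a system of height `n` (the values `S(k)` with `k > n` are irrelevant). -/
structure IsSystem (A B : ℕ → Set G) (n : ℕ) (S : ℕ → Set G) : Prop where
  top : S n = {1}
  one_mem : ∀ k < n, (1 : G) ∈ S k
  maximal : ∀ k < n, Maximal (fun T => T ⊆ admissible A B n S k ∧ IsSpaced (A k) T) (S k)

/-- The restriction `(g · S)|_m`, whose `k`-th member is `(S(k) ∩ A_m g) g⁻¹`. -/
def relSystem (A : ℕ → Set G) (S : ℕ → Set G) (g : G) (m k : ℕ) : Set G :=
  (S k ∩ (A m * {g})) * {g⁻¹}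

/-- A system of height `n` is uniform if `(g · S)|_m` does not depend on `g ∈ S(m)`. -/
def IsUniform (A : ℕ → Set G) (n : ℕ) (S : ℕ → Set G) : Prop :=
  ∀ m ≤ n, ∀ g ∈ S m, ∀ h ∈ S m, ∀ k ≤ m, relSystem A S g m k = relSystem A S h m k

/-- A coherent sequence: uniform systems `S_n` of height `n` with `S_n|_m = S_m` for `m ≤ n`. -/
structure IsCoherent (A B : ℕ → Set G) (S : ℕ → ℕ → Set G) : Prop where
  system : ∀ n, IsSystem A B n (S n)
  uniform : ∀ n, IsUniform A n (S n)
  restrict : ∀ n, ∀ m ≤ n, ∀ k ≤ m, relSystem A (S n) 1 m k = S m k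

/-- `S_n(k) ∖ ⋃_{k < m < n} A_m S_n(m)`: the centres of the `A_k`-tiles in `A_n` that lie in no
larger tile. -/
def outerCentres (A : ℕ → Set G) (S : ℕ → ℕ → Set G) (n k : ℕ) : Set G :=
  S n k \ ⋃ m, ⋃ (_ : k < m ∧ m < n), A m * S n m

end Systems

/-! ### Irreducibility and printing -/

section Irreducible

variable {H α : Type*} [Group H]

/-- `D`-irreducibility. -/
def IsIrreducibleWith (D : Set H) (X : Set (FullShift H α)) : Prop :=
  ∀ S₀ S₁ : Set H, IsApart D S₀ S₁ → ∀ x₀ ∈ X, ∀ x₁ ∈ X,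
    ∃ y ∈ X, (∀ s ∈ S₀, y s = x₀ s) ∧ ∀ s ∈ S₁, y s = x₁ s

/-- Strong irreducibility. -/
def IsStronglyIrreducible (X : Set (FullShift H α)) : Prop :=
  ∃ D : Set H, D.Finite ∧ IsIrreducibleWith D X

/-- The restriction of a configuration to `C ⊆ H`. -/
def pattern (C : Set H) (x : FullShift H α) : C → α := fun c => x c

/-- The set `P_C(X)` of `C`-patterns of `X`. -/
def patterns (C : Set H) (X : Set (FullShift H α)) : Set (C → α) := pattern C '' X

/-- the labelled partitions of `H` into `N` sets, each of them `C`-spaced. -/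
def spacedPartitions (C : Set H) (N : ℕ) : Set (FullShift H (Fin N)) :=
  {γ | ∀ k, IsSpaced C {h | γ h = k}}

/-- `|(DC)⁻¹ (DC)|`. -/
noncomputable def printCard (D C : Set H) : ℕ := ((D * C)⁻¹ * (D * C)).ncard

/-- `Print(X, p, N)`, for `N = |(DC)⁻¹ (DC)|`: the tuples of elements of `X` such that for some
`γ ∈ spacedPartitions (D * C) N` and all `h` the pattern of `h • x_{γ(h)}` on `C` is `p`. -/
def Print (D C : Set H) (X : Set (FullShift H α)) (p : C → α) :
    Set (Fin (printCard D C) → FullShift H α) :=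
  {x | (∀ i, x i ∈ X) ∧ ∃ γ ∈ spacedPartitions (D * C) (printCard D C), ∀ h, pattern C (h • x (γ h)) = p}

end Irreducible

/-- For `y ∈ (2^E)^H` and `F g ⊆ E`, the element `g · (y|_{F g})` of `(2^F)^H`, whose value at
`h` and `a ∈ F` is `y(h)(a g)`. -/
noncomputable def window {G H : Type*} [Group G] (E F : Set G) (g : G)
    (y : FullShift H (E → Bool)) : FullShift H (F → Bool) :=
  open Classical in fun h a => if ha : (a : G) * g ∈ E then y h ⟨a * g, ha⟩ else false

/-! ### The construction -/

/-- All choices made in the construction. The sets `Y n` are determined by the other data through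
`Y_zero` and `Y_succ`. -/
structure Construction (G H : Type*) [Group G] [Group H] where
  /-- the exhaustion of `G` -/
  A : ℕ → Set G
  /-- the last factors in `A_n = A_0 ^ 3 ⋯ A_{n-1} ^ 3 * B_n` -/
  B : ℕ → Set G
  /-- the coherent sequence -/
  S : ℕ → ℕ → Set G
  /-- the exhaustion of `H` -/
  C : ℕ → Set H
  /-- the `H`-subshifts `Y_n` of `(2^{A_n})^H` -/
  Y : ∀ n, Set (FullShift H (A n → Bool))
  /-- witnesses of the irreducibility of `Y_0, …, Y_n` -/
  D : ℕ → Set H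
  /-- for each pattern `p` of `Y_n` on `C_n`, an enumeration of the set of those centres in
  `S_{n+1}(n)` around which `p` is printed -/
  F : ∀ n, patterns (C n) (Y n) → Fin (printCard (D n) (C n)) → G
  exhaustion_A : IsExhaustion A
  finite_B : ∀ n, (B n).Finite
  one_mem_B : ∀ n, (1 : G) ∈ B n
  A_eq : ∀ n, A n = innerBlock A B n 0
  coherent : IsCoherent A B S
  exhaustion_C : IsExhaustion C
  D_zero : D 0 = {1}
  finite_D : ∀ n, (D n).Finite
  symm_D : ∀ n, (D n)⁻¹ = D n
  irreducible : ∀ n, ∀ k ≤ n, IsIrreducibleWith (D n) (Y k)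
  /-- there are enough centres -/
  card_lt : ∀ n, printCard (D n) (C n) * 2 ^ ((A n).ncard * (C n).ncard) <
    (outerCentres A S (n + 1) n).ncard
  F_mem : ∀ n p j, F n p j ∈ outerCentres A S (n + 1) n
  F_ne_one : ∀ n p j, F n p j ≠ 1
  F_injective : ∀ n, Function.Injective (Function.uncurry (F n))
  Y_zero : Y 0 = Set.univ
  /-- `Y_{n+1}` is the product over the outer tiles of translates of `Y_k` for `k < n`, of
  translates of `Y_n` around the centres in `S_{n+1}(n)` that are not enumerated by `F`, of the
  translates of `Print(Y_n, p, N)` around the centres `F n p 0, …, F n p (N-1)`, and of the full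
  shift over the complement of the tiles. -/
  Y_succ : ∀ n, Y (n + 1) = {y |
    (∀ k < n, ∀ g ∈ outerCentres A S (n + 1) k, window (A (n + 1)) (A k) g y ∈ Y k) ∧
    (∀ g ∈ outerCentres A S (n + 1) n, (∀ p j, F n p j ≠ g) →
      window (A (n + 1)) (A n) g y ∈ Y n) ∧
    ∀ p : patterns (C n) (Y n), (fun j => window (A (n + 1)) (A n) (F n p j) y) ∈
      Print (D n) (C n) (Y n) p.1}

section Invariance

variable {H α : Type*} [Group H]

theorem smul_mem_spacedPartitions {C : Set H} {N : ℕ} (h : H) {γ : FullShift H (Fin N)}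
    (hγ : γ ∈ spacedPartitions C N) : h • γ ∈ spacedPartitions C N := by
  intro k g hg g' hg' hne
  have key := hγ k (g * h) hg (g' * h) hg' (fun e => hne (mul_right_cancel e))
  unfold IsApart at key ⊢
  rw [Set.disjoint_left] at key ⊢
  rintro x ⟨a, ha, b, hb, hx⟩ ⟨a', ha', b', hb', hx'⟩
  rw [Set.mem_singleton_iff] at hb hb'
  subst hb hb'
  refine key (a := x * h) ⟨a, ha, _, rfl, ?_⟩ ⟨a', ha', _, rfl, ?_⟩
  · simp only [← hx, mul_assoc]
  · simp only [← hx', mul_assoc]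

theorem smul_mem_Print {D C : Set H} {X : Set (FullShift H α)} {p : C → α}
    (hX : ∀ h : H, ∀ x ∈ X, h • x ∈ X) (h : H) {x : Fin (printCard D C) → FullShift H α}
    (hx : x ∈ Print D C X p) : (fun i => h • x i) ∈ Print D C X p := by
  obtain ⟨hx1, γ, hγ, hp⟩ := hx
  refine ⟨fun i => hX h _ (hx1 i), h • γ, smul_mem_spacedPartitions h hγ, fun l => ?_⟩
  have e := hp (l * h)
  rw [mul_smul] at e
  exact e

end Invariance

namespace Construction

variable {G H : Type*} [Group G] [Group H] (K : Construction G H)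

/-- The restriction `x|_{A_n × H}` of `x ∈ 2^{G × H}`, as an element of `(2^{A_n})^H`. -/
def proj (n : ℕ) (x : FullShift (G × H) Bool) : FullShift H (K.A n → Bool) :=
  fun h a => x (a, h)

/-- The inverse limit of the `Y_n`, as a subset of `2^{G × H}`. -/
def limY : Set (FullShift (G × H) Bool) := {x | ∀ n, K.proj n x ∈ K.Y n}

theorem smul_mem_Y (n : ℕ) : ∀ h : H, ∀ y ∈ K.Y n, h • y ∈ K.Y n := by
  induction n using Nat.strong_induction_on with
  | _ n ih =>
    intro h y hy
    cases n with
    | zero => rw [K.Y_zero]; trivial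
    | succ n =>
      rw [K.Y_succ] at hy ⊢
      obtain ⟨h1, h2, h3⟩ := hy
      refine ⟨fun k hk g hg => ?_, fun g hg hF => ?_, fun p => ?_⟩
      · exact ih k (by omega) h _ (h1 k hk g hg)
      · exact ih n (by omega) h _ (h2 g hg hF)
      · exact smul_mem_Print (ih n (by omega)) h (h3 p)

theorem smul_mem_limY (h : H) {x : FullShift (G × H) Bool} (hx : x ∈ K.limY) :
    ((1, h) : G × H) • x ∈ K.limY := by
  intro n
  have e : K.proj n (((1, h) : G × H) • x) = h • K.proj n x := by
    funext l a
    change x ((a : G) * 1, l * h) = x (a, l * h)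
    rw [mul_one]
  rw [e]
  exact K.smul_mem_Y n h _ (hx n)

/-- `G · Y`. -/
def orbitY : Set (FullShift (G × H) Bool) :=
  {z | ∃ g : G, ∃ x ∈ K.limY, z = ((g, 1) : G × H) • x}

/-- `X`, the closure of `G · Y` in `2^{G × H}`, as a set with an action of `G × H`. -/
def X : SubMulAction (G × H) (FullShift (G × H) Bool) where
  carrier := closure K.orbitY
  smul_mem' := by
    rintro ⟨g, h⟩ x hx
    refine map_mem_closure (continuous_const_smul ((g, h) : G × H)) hx ?_
    rintro _ ⟨g', x', hx', rfl⟩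
    refine ⟨g * g', _, K.smul_mem_limY h hx', ?_⟩
    rw [← mul_smul, ← mul_smul]
    simp

/-- `X` as a `G`-flow: `g` acts as `(g, 1)`. -/
instance actionG : MulAction G K.X := MulAction.compHom K.X (MonoidHom.inl G H)

/-- `X` as an `H`-flow: `h` acts as `(1, h)`. -/
instance actionH : MulAction H K.X := MulAction.compHom K.X (MonoidHom.inr G H)

end Construction

/-! ### Block exhaustions and nesting of tiles -/

section Blocks

variable {G : Type*} [Group G]

/-! Minimality comes from printing. In every element of `Y (n + 1)`, each pattern p of `Y n` on `C
n` is seen from every position of H around one of boundedly many centres: a colouring of H decides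
which centre serves which position. The centres of level n + 1 are syndetic in G, with gaps bounded
independently of the ambient level (`IsCoherent.exists_syndetic`). So each pattern of the inverse
limit on A_n × C_n recurs with bounded gaps along every G-orbit in `X`
(`exists_syndetic_occurrences`), and all G-orbits are dense. Freeness then follows from minimality:
the fixed point set of h ≠ 1 is closed and G-invariant, hence empty or everything, and the latter
fails because `Y 0` is a full shift all of whose points extend to the inverse limit.

The construction never stops because printing keeps strong irreducibility (`Print_irreducible`). Two
tuples are interpolated by interpolating their colourings, completing the result greedily, and then
printing the missing copies of p in each coordinate. Outer tiles are disjoint, so the conditions on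
different tiles are independent, which passes irreducibility to the next level
(`nextSet_irreducible`). Points lift from `Y n` to `Y (n + 1)` because the tile centred at 1 is
never used for printing (`exists_mem_nextSet`).

On the side of G, the cubes in A_n = A_0³⋯A_{n-1}³B_n leave room for a collar, so that tiles which
meet are nested (`nested`, `nested_deep`). Coherent sequences are built from the top level down:
copies inside larger tiles are forced, and the rest is completed maximally (`exists_level`). Large
B_{n+1} give many centres of level n (`IsSystem.ncard_le`). The sets D_n can be chosen from C alone,
so the required number is known in time. -/

theorem mem_mul_singleton_iff {D : Set G} {x g : G} : x ∈ D * {g} ↔ x * g⁻¹ ∈ D := by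
  simp

theorem isSpaced_iff {D S : Set G} :
    IsSpaced D S ↔ ∀ g ∈ S, ∀ h ∈ S, ∀ x, x * g⁻¹ ∈ D → x * h⁻¹ ∈ D → g = h := by
  unfold IsSpaced IsApart
  refine forall₄_congr fun g _ h _ => ?_
  rw [Set.disjoint_left]
  simp only [mem_mul_singleton_iff]
  constructor
  · intro H x hx hy
    by_contra hne
    exact H hne hx hy
  · intro H hne x hx hy
    exact hne (H x hx hy)

/-- An exhaustion of the form `A_n = A_0 ^ 3 ⋯ A_{n-1} ^ 3 * B_n`. -/
structure IsBlockExhaustion (A B : ℕ → Set G) : Prop where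
  exhaustion : IsExhaustion A
  one_mem_B : ∀ n, (1 : G) ∈ B n
  eq_innerBlock : ∀ n, A n = innerBlock A B n 0

theorem innerBlock_self (A B : ℕ → Set G) (n : ℕ) : innerBlock A B n n = B n := by
  simp [innerBlock]

theorem innerBlock_eq_mul (A B : ℕ → Set G) {n k m : ℕ} (hkm : k ≤ m) (hmn : m ≤ n) :
    innerBlock A B n k = ((List.Ico k m).map fun i => A i ^ 3).prod * innerBlock A B n m := by
  unfold innerBlock
  rw [← mul_assoc, ← List.prod_append, ← List.map_append, List.Ico.append_consecutive hkm hmn]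

theorem innerBlock_succ (A B : ℕ → Set G) {n k : ℕ} (h : k < n) :
    innerBlock A B n k = A k ^ 3 * innerBlock A B n (k + 1) := by
  rw [innerBlock_eq_mul A B (Nat.le_succ k) h]
  simp [List.Ico.succ_singleton]

theorem mul_mul_mul_mem_innerBlock {A B : ℕ → Set G} {n k : ℕ} (h : k < n) {a b c x : G}
    (ha : a ∈ A k) (hb : b ∈ A k) (hc : c ∈ A k) (hx : x ∈ innerBlock A B n (k + 1)) :
    a * b * c * x ∈ innerBlock A B n k := by
  rw [innerBlock_succ A B h]
  refine ⟨a * b * c, ?_, x, hx, rfl⟩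
  rw [pow_succ, pow_two]
  exact ⟨a * b, ⟨a, ha, b, hb, rfl⟩, c, hc, rfl⟩

namespace IsBlockExhaustion

variable {A B : ℕ → Set G} (hA : IsBlockExhaustion A B)
include hA

theorem one_mem (n : ℕ) : (1 : G) ∈ A n := hA.exhaustion.one_mem n

theorem inv_mem {n : ℕ} {x : G} (hx : x ∈ A n) : x⁻¹ ∈ A n := by
  rw [← hA.exhaustion.symm n]; simpa using hx

theorem one_mem_prod (k m : ℕ) : (1 : G) ∈ ((List.Ico k m).map fun i => A i ^ 3).prod := by
  generalize List.Ico k m = L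
  induction L with
  | nil => simp
  | cons a L ih =>
    rw [List.map_cons, List.prod_cons]
    exact ⟨1, Set.one_mem_pow (hA.one_mem a), 1, ih, one_mul 1⟩

theorem innerBlock_anti {n k m : ℕ} (hkm : k ≤ m) (hmn : m ≤ n) :
    innerBlock A B n m ⊆ innerBlock A B n k := by
  rw [innerBlock_eq_mul A B hkm hmn]
  intro x hx
  exact ⟨1, hA.one_mem_prod k m, x, hx, one_mul x⟩

theorem innerBlock_subset {n k : ℕ} (h : k ≤ n) : innerBlock A B n k ⊆ A n := by
  rw [hA.eq_innerBlock n]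
  exact hA.innerBlock_anti (Nat.zero_le k) h

theorem mul_mem_innerBlock {n k : ℕ} (h : k < n) {a x : G} (ha : a ∈ A k)
    (hx : x ∈ innerBlock A B n (k + 1)) : a * x ∈ innerBlock A B n k := by
  simpa using mul_mul_mul_mem_innerBlock h ha (hA.one_mem k) (hA.one_mem k) hx

/-- The factor A_j³, which stands to the left of A_n(k) in A_n, absorbs the multiplication by A_j.
This is the source of all collars. -/
theorem mul_mem_of_mem_innerBlock {n k j : ℕ} (hjk : j < k) (hkn : k ≤ n) {a x : G}
    (ha : a ∈ A j) (hx : x ∈ innerBlock A B n k) : a * x ∈ A n :=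
  hA.innerBlock_subset (by omega)
    (hA.mul_mem_innerBlock (by omega) ha (hA.innerBlock_anti hjk hkn hx))

theorem one_mem_innerBlock {n k : ℕ} (h : k ≤ n) : (1 : G) ∈ innerBlock A B n k :=
  hA.innerBlock_anti h le_rfl (by rw [innerBlock_self]; exact hA.one_mem_B n)

theorem subset_innerBlock {n k : ℕ} (h : k < n) : A k ⊆ innerBlock A B n k := by
  intro a ha
  simpa using hA.mul_mem_innerBlock h ha (hA.one_mem_innerBlock (show k + 1 ≤ n by omega))

/-- `A_k` is the union of a finite number of translates of the inner blocks, uniformly in `n`. -/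
theorem exists_finite_shift (k : ℕ) : ∃ R : Set G, R.Finite ∧ ∀ n, k < n → ∀ x ∈ A n,
    ∃ r ∈ R, r * x ∈ innerBlock A B n (k + 1) := by
  refine ⟨(((List.Ico 0 (k + 1)).map fun i => A i ^ 3).prod)⁻¹, ?_, ?_⟩
  · apply Set.Finite.inv
    generalize List.Ico 0 (k + 1) = L
    induction L with
    | nil => simp
    | cons a L ih =>
      rw [List.map_cons, List.prod_cons]
      refine Set.Finite.mul ?_ ih
      have := hA.exhaustion.finite a
      rw [pow_succ, pow_two]
      exact (this.mul this).mul this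
  · intro n hn x hx
    rw [hA.eq_innerBlock n, innerBlock_eq_mul A B (Nat.zero_le (k + 1)) hn] at hx
    obtain ⟨u, hu, v, hv, rfl⟩ := hx
    exact ⟨u⁻¹, by simpa using hu, by simpa using hv⟩

/-- The requirement that A_k g meet A_l S(l) disappears: it follows from the containment, since 1 ∈
A_k and A_l(k) ⊆ A_l. -/
theorem mem_admissible_iff {n k : ℕ} {S : ℕ → Set G} {g : G} :
    g ∈ admissible A B n S k ↔ g ∈ A n ∧ ∃ l, k < l ∧ l ≤ n ∧
      (∃ h ∈ S l, ∀ a ∈ A k, a * g * h⁻¹ ∈ innerBlock A B l k) ∧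
      ∀ m, k < m → m < l → ∀ h ∈ S m, ∀ a ∈ A k, a * g * h⁻¹ ∉ A m := by
  have key : ∀ m, (A k * {g}) ∩ (A m * S m) = ∅ ↔ ∀ h ∈ S m, ∀ a ∈ A k, a * g * h⁻¹ ∉ A m := by
    intro m
    rw [Set.eq_empty_iff_forall_notMem]
    constructor
    · intro H h hh a ha hm
      exact H (a * g) ⟨⟨a, ha, g, rfl, rfl⟩, ⟨_, hm, h, hh, by simp⟩⟩
    · rintro H x ⟨⟨a, ha, _, rfl, rfl⟩, ⟨b, hb, h, hh, e⟩⟩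
      refine H h hh a ha ?_
      simp only at e
      rw [← e]; simpa using hb
  have key2 : ∀ l (h : G), A k * {g} ⊆ innerBlock A B l k * {h} ↔
      ∀ a ∈ A k, a * g * h⁻¹ ∈ innerBlock A B l k := by
    intro l h
    constructor
    · intro H a ha
      exact mem_mul_singleton_iff.1 (H ⟨a, ha, g, rfl, rfl⟩)
    · rintro H x ⟨a, ha, _, rfl, rfl⟩
      exact mem_mul_singleton_iff.2 (H a ha)
  unfold admissible
  simp only [Set.mem_ofPred_eq, key, key2]
  constructor
  · rintro ⟨hg, l, h1, h2, -, h3, h4⟩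
    exact ⟨hg, l, h1, h2, h4, h3⟩
  · rintro ⟨hg, l, h1, h2, h4, h3⟩
    refine ⟨hg, l, h1, h2, ?_, h3, h4⟩
    obtain ⟨h, hh, H⟩ := h4
    refine ⟨g, ⟨1, hA.one_mem k, g, rfl, one_mul g⟩, ?_⟩
    have := hA.innerBlock_subset h1.le (H 1 (hA.one_mem k))
    exact ⟨_, this, h, hh, by simp⟩

end IsBlockExhaustion

/-- The levels `k₀, …, n` of a system of height `n`. -/
structure IsSystemAbove (A B : ℕ → Set G) (n : ℕ) (S : ℕ → Set G) (k₀ : ℕ) : Prop where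
  top : S n = {1}
  one_mem : ∀ k, k₀ ≤ k → k < n → (1 : G) ∈ S k
  maximal : ∀ k, k₀ ≤ k → k < n →
    Maximal (fun T => T ⊆ admissible A B n S k ∧ IsSpaced (A k) T) (S k)

theorem IsSystem.above {A B : ℕ → Set G} {n : ℕ} {S : ℕ → Set G} (h : IsSystem A B n S)
    (k₀ : ℕ) : IsSystemAbove A B n S k₀ :=
  ⟨h.top, fun k _ => h.one_mem k, fun k _ => h.maximal k⟩

namespace IsSystemAbove

variable {A B : ℕ → Set G} (hA : IsBlockExhaustion A B) {n k₀ : ℕ} {S : ℕ → Set G}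
  (hS : IsSystemAbove A B n S k₀)

include hS in
theorem one_mem' {k : ℕ} (h₀ : k₀ ≤ k) (hk : k ≤ n) : (1 : G) ∈ S k := by
  rcases hk.eq_or_lt with rfl | hk
  · rw [hS.top]; rfl
  · exact hS.one_mem k h₀ hk

include hS in
theorem eq_of_mem {k : ℕ} (h₀ : k₀ ≤ k) (hk : k ≤ n) {g h x : G} (hg : g ∈ S k) (hh : h ∈ S k)
    (hx : x * g⁻¹ ∈ A k) (hx' : x * h⁻¹ ∈ A k) : g = h := by
  rcases hk.eq_or_lt with rfl | hk
  · rw [hS.top] at hg hh; rw [hg, hh]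
  · exact isSpaced_iff.1 (hS.maximal k h₀ hk).prop.2 g hg h hh x hx hx'

include hA hS

/-- A tile that meets a tile of larger level lies deeply inside it. -/
theorem nested_aux (d : ℕ) : ∀ k l, n - k = d → k₀ ≤ k → k < l → l ≤ n → ∀ g ∈ S k, ∀ h ∈ S l, ∀ x,
    x * g⁻¹ ∈ A k → x * h⁻¹ ∈ A l → ∀ b ∈ A k,
      b * g * h⁻¹ ∈ A l ∧ ∀ j < k, ∀ a ∈ A j, a * b * g * h⁻¹ ∈ A l := by
  induction d using Nat.strong_induction_on with
  | _ d ih =>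
    intro k l hd h₀ hkl hln g hg h hh x hxg hxh b hb
    have hadm := (hS.maximal k h₀ (by omega)).prop.1 hg
    rw [hA.mem_admissible_iff] at hadm
    obtain ⟨hgn, l', hkl', hl'n, ⟨h', hh', Hin⟩, Hout⟩ := hadm
    have hxin := Hin _ hxg
    rw [inv_mul_cancel_right] at hxin
    have hx' : x * h'⁻¹ ∈ A l' := hA.innerBlock_subset hkl'.le hxin
    have hb' := Hin b hb
    -- Here l' is the level witnessing that g is admissible. If l < l', minimality of l' is
    -- violated; if l = l', spacing identifies the two centres; if l' < l, induction applies to the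
    -- tile at h', which contains the tile at g and its collars.
    rcases lt_trichotomy l l' with hlt | rfl | hlt
    · exact absurd hxh (by simpa using Hout l hkl hlt h hh _ hxg)
    · obtain rfl := hS.eq_of_mem (by omega) hln hh hh' hxh hx'
      refine ⟨hA.innerBlock_subset hkl.le hb', fun j hj a ha => ?_⟩
      have := hA.mul_mem_of_mem_innerBlock hj hkl.le ha hb'
      simpa only [mul_assoc] using this
    · have IH := ih (n - l') (by omega) l' l rfl (by omega) hlt hln h' hh' h hh x hx' hxh
      refine ⟨?_, fun j hj a ha => ?_⟩
      · simpa using (IH _ (hA.innerBlock_subset hkl'.le hb')).1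
      · simpa [mul_assoc] using (IH _ (hA.mul_mem_of_mem_innerBlock hj hkl'.le ha hb')).1

theorem nested {k l : ℕ} (h₀ : k₀ ≤ k) (hkl : k ≤ l) (hln : l ≤ n) {g h x y : G} (hg : g ∈ S k)
    (hh : h ∈ S l) (hx : x * g⁻¹ ∈ A k) (hx' : x * h⁻¹ ∈ A l) (hy : y * g⁻¹ ∈ A k) :
    y * h⁻¹ ∈ A l := by
  rcases hkl.eq_or_lt with rfl | hkl
  · rwa [← hS.eq_of_mem h₀ hln hg hh hx hx']
  · simpa using (nested_aux hA hS _ k l rfl h₀ hkl hln g hg h hh x hx hx' _ hy).1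

theorem nested_deep {j k l : ℕ} (h₀ : k₀ ≤ k) (hjk : j < k) (hkl : k < l) (hln : l ≤ n)
    {g h x y a : G} (hg : g ∈ S k) (hh : h ∈ S l) (hx : x * g⁻¹ ∈ A k) (hx' : x * h⁻¹ ∈ A l)
    (ha : a ∈ A j) (hy : y * g⁻¹ ∈ A k) : a * y * h⁻¹ ∈ A l := by
  simpa [mul_assoc] using
    (nested_aux hA hS _ k l rfl h₀ hkl hln g hg h hh x hx hx' _ hy).2 j hjk a ha

theorem subset {k : ℕ} (h₀ : k₀ ≤ k) (hk : k ≤ n) : S k ⊆ A n := by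
  rcases hk.eq_or_lt with rfl | hk
  · rw [hS.top]; simpa using hA.one_mem k
  · exact fun g hg => ((hA.mem_admissible_iff).1 ((hS.maximal k h₀ hk).prop.1 hg)).1

theorem tile_subset {k : ℕ} (h₀ : k₀ ≤ k) (hk : k ≤ n) {g y : G} (hg : g ∈ S k)
    (hy : y * g⁻¹ ∈ A k) : y ∈ A n := by
  have h1 : (1 : G) ∈ S n := by rw [hS.top]; rfl
  have := nested hA hS h₀ hk le_rfl (x := g) hg h1 (by simpa using hA.one_mem k)
    (by simpa using subset hA hS h₀ hk hg) hy
  simpa using this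

/-- Otherwise g could be added to S(k), against maximality. -/
theorem exists_of_admissible {k : ℕ} (h₀ : k₀ ≤ k) (hk : k < n) {g : G}
    (hg : g ∈ admissible A B n S k) : ∃ s ∈ S k, ∃ x, x * g⁻¹ ∈ A k ∧ x * s⁻¹ ∈ A k := by
  by_contra! hcon
  have hmax := hS.maximal k h₀ hk
  have hins : insert g (S k) ⊆ S k := by
    refine hmax.le_of_ge ⟨Set.insert_subset hg hmax.prop.1, ?_⟩ (Set.subset_insert _ _)
    rw [isSpaced_iff]
    rintro a (rfl | ha) b (rfl | hb) x hx hy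
    · rfl
    · exact absurd hy (hcon b hb x hx)
    · exact absurd hx (hcon a ha x hy)
    · exact isSpaced_iff.1 hmax.prop.2 a ha b hb x hx hy
  exact hcon g (hins (Set.mem_insert _ _)) g (by simpa using hA.one_mem k)
    (by simpa using hA.one_mem k)

end IsSystemAbove

end Blocks

/-! ### Existence of coherent sequences -/

section Coherent

variable {G : Type*} [Group G]

theorem mem_relSystem_iff {A S : ℕ → Set G} {g x : G} {m k : ℕ} :
    x ∈ relSystem A S g m k ↔ x * g ∈ S k ∧ x ∈ A m := by
  unfold relSystem
  rw [mem_mul_singleton_iff, Set.mem_inter_iff, mem_mul_singleton_iff]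
  simp

/-- Inside every tile of level `l ≤ N`, the levels of `T` from `k₀` on form a copy of `S l`. -/
def HasCopies (A : ℕ → Set G) (S : ℕ → ℕ → Set G) (N : ℕ) (T : ℕ → Set G) (k₀ : ℕ) : Prop :=
  ∀ l ≤ N, ∀ k ≤ l, k₀ ≤ k → ∀ g ∈ T l, ∀ t, t ∈ S l k ↔ t * g ∈ T k ∧ t ∈ A l

/-- Uniformity compares any tile with the one centred at 1, and restriction identifies that one with
`S l`. Copies merge both conditions into one that can be built level by level. -/
theorem IsCoherent.hasCopies {A B : ℕ → Set G} {S : ℕ → ℕ → Set G} (h : IsCoherent A B S) (n : ℕ) :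
    HasCopies A S n (S n) 0 := by
  intro l hl k hk _ g hg t
  rw [← h.restrict n l hl k hk, ← mem_relSystem_iff]
  rw [h.uniform n l hl 1 (((h.system n).above 0).one_mem' (Nat.zero_le l) hl) g hg k hk]

theorem IsCoherent.of_hasCopies {A B : ℕ → Set G} {S : ℕ → ℕ → Set G}
    (hS : ∀ n, IsSystem A B n (S n)) (h : ∀ n, HasCopies A S n (S n) 0) : IsCoherent A B S where
  system := hS
  uniform := by
    intro n m hm g hg g' hg' k hk
    ext x
    rw [mem_relSystem_iff, mem_relSystem_iff, ← h n m hm k hk (Nat.zero_le k) g hg,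
      ← h n m hm k hk (Nat.zero_le k) g' hg']
  restrict := by
    intro n m hm k hk
    ext x
    rw [mem_relSystem_iff, ← h n m hm k hk (Nat.zero_le k) 1
      (((hS n).above 0).one_mem' (Nat.zero_le m) hm)]

theorem admissible_congr {A B : ℕ → Set G} {n k : ℕ} {S T : ℕ → Set G}
    (h : ∀ l, k < l → S l = T l) : admissible A B n S k = admissible A B n T k := by
  ext g
  unfold admissible
  simp only [Set.mem_ofPred_eq]
  refine and_congr_right fun _ => exists_congr fun l => and_congr_right fun hl => ?_
  rw [h l hl]
  refine and_congr_right fun _ => and_congr_right fun _ => and_congr_left fun _ => ?_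
  refine forall₃_congr fun m hm _ => ?_
  rw [h m hm]

theorem exists_maximal_isSpaced {D P E : Set G} (hPE : P ⊆ E) (hP : IsSpaced D P) :
    ∃ T, P ⊆ T ∧ Maximal (fun T => T ⊆ E ∧ IsSpaced D T) T := by
  obtain ⟨T, hPT, hT⟩ := zorn_subset_nonempty {T | T ⊆ E ∧ IsSpaced D T} (by
    intro c hc hchain hne
    refine ⟨⋃₀ c, ⟨Set.sUnion_subset fun T hT => (hc hT).1, ?_⟩, fun T hT =>
      Set.subset_sUnion_of_mem hT⟩
    rintro g ⟨T, hT, hg⟩ h ⟨T', hT', hh⟩ hne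
    rcases hchain.total hT hT' with hle | hle
    · exact (hc hT').2 g (hle hg) h hh hne
    · exact (hc hT).2 g hg h (hle hh) hne) P ⟨hPE, hP⟩
  exact ⟨T, hPT, hT⟩

variable {A B : ℕ → Set G} (hA : IsBlockExhaustion A B) {n : ℕ} {S : ℕ → ℕ → Set G}
  (hS : ∀ j ≤ n, IsSystem A B j (S j)) (hC : ∀ j ≤ n, HasCopies A S j (S j) 0)

include hA hS

/-- The points of level `k` forced by the copies inside larger tiles are admissible. -/
theorem copy_mem_admissible {k : ℕ} {T : ℕ → Set G} (hT : IsSystemAbove A B (n + 1) T (k + 1))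
    (hTC : HasCopies A S n T (k + 1)) {l : ℕ} (hkl : k < l) (hl : l ≤ n) {t g : G}
    (ht : t ∈ S l k) (hg : g ∈ T l) : t * g ∈ admissible A B (n + 1) T k := by
  have hSl := (hS l hl).above 0
  have hadm := ((hS l hl).maximal k hkl).prop.1 ht
  rw [hA.mem_admissible_iff] at hadm ⊢
  obtain ⟨htl, l', hkl', hl'l, ⟨h', hh', Hin⟩, Hout⟩ := hadm
  have htg : t * g ∈ A (n + 1) :=
    hT.tile_subset hA (k := l) (by omega) (by omega) hg (by simpa using htl)
  have hh'T := (hTC l hl l' hl'l hkl' g hg h').1 hh'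
  refine ⟨htg, l', hkl', by omega, ⟨h' * g, hh'T.1, fun a ha => ?_⟩, ?_⟩
  · simpa [mul_assoc] using Hin a ha
  -- A tile of smaller level m in the way would meet the tile at g, hence lie inside it and be a
  -- copy of a tile of `S l`; admissibility of t in `S l` excludes that.
  · intro m hkm hml' h hh a ha hah
    have h1 : a * t * h'⁻¹ ∈ A l' := hA.innerBlock_subset hkl'.le (Hin a ha)
    have h2 : a * (t * g) * g⁻¹ ∈ A l := by
      have := hSl.tile_subset hA (Nat.zero_le l') hl'l hh' h1
      simpa [mul_assoc] using this
    have h3 : h * g⁻¹ ∈ A l := hT.nested hA (k := m) (l := l) hkm (by omega) (by omega) hh hg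
      hah h2 (by simpa using hA.one_mem m)
    have h4 : h * g⁻¹ ∈ S l m :=
      (hTC l hl m (by omega) hkm g hg _).2 ⟨by simpa using hh, h3⟩
    exact Hout m hkm hml' _ h4 a ha (by simpa [mul_assoc] using hah)

include hC

/-- The surrounding tiles meet, so the smaller one is nested in the larger and is itself a copy of a
tile of `S l'`. Both points then come from `S l' k`, which is spaced. -/
theorem copy_eq_copy {k : ℕ} {T : ℕ → Set G} (hT : IsSystemAbove A B (n + 1) T (k + 1))
    (hTC : HasCopies A S n T (k + 1)) {l l' : ℕ} (hkl : k < l) (hll' : l ≤ l') (hl' : l' ≤ n)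
    {t t' g g' x : G} (ht : t ∈ S l k) (hg : g ∈ T l) (ht' : t' ∈ S l' k) (hg' : g' ∈ T l')
    (hx : x * (t * g)⁻¹ ∈ A k) (hx' : x * (t' * g')⁻¹ ∈ A k) : t * g = t' * g' := by
  have aux : ∀ l, k < l → l ≤ n → ∀ t ∈ S l k, ∀ g : G, x * (t * g)⁻¹ ∈ A k → x * g⁻¹ ∈ A l := by
    intro l hkl hl t ht g hx
    refine ((hS l hl).above 0).tile_subset hA (Nat.zero_le k) hkl.le ht ?_
    simpa [mul_assoc] using hx
  have h1 := aux l hkl (by omega) t ht g hx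
  have h2 := aux l' (by omega) hl' t' ht' g' hx'
  have h3 : g * g'⁻¹ ∈ A l' := hT.nested hA hkl hll' (by omega) hg hg' h1 h2
    (by simpa using hA.one_mem l)
  have h4 : g * g'⁻¹ ∈ S l' l :=
    (hTC l' hl' l hll' hkl g' hg' _).2 ⟨by simpa using hg, h3⟩
  have h5 : t * (g * g'⁻¹) ∈ S l' k :=
    ((hC l' hl' l hll' k hkl.le (Nat.zero_le k) _ h4 t).1 ht).1
  have h6 := ((hS l' hl').above 0).eq_of_mem (Nat.zero_le k) (by omega) h5 ht' (x := x * g'⁻¹)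
    (by simpa [mul_assoc] using hx) (by simpa [mul_assoc] using hx')
  rw [← h6]; simp [mul_assoc]

/-- The points forced by copies inside larger tiles are admissible and spaced, so they extend to a
maximal set. No further point appears inside a tile, because the copy there is already maximal. -/
theorem exists_level {k : ℕ} (hk : k ≤ n) {T : ℕ → Set G}
    (hT : IsSystemAbove A B (n + 1) T (k + 1)) (hTC : HasCopies A S n T (k + 1)) :
    ∃ T', IsSystemAbove A B (n + 1) T' k ∧ HasCopies A S n T' k := by
  classical
  -- Inserting 1 matters only for k = n, where nothing is forced; for k < n the point 1 is already a
  -- copy.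
  set P : Set G := insert 1 {x | ∃ l, k < l ∧ l ≤ n ∧ ∃ t ∈ S l k, ∃ g ∈ T l, x = t * g} with hP
  have hPor : P = {1} ∨ P = {x | ∃ l, k < l ∧ l ≤ n ∧ ∃ t ∈ S l k, ∃ g ∈ T l, x = t * g} := by
    rcases hk.eq_or_lt with rfl | hkn
    · left
      rw [hP]
      refine Set.eq_singleton_iff_unique_mem.2 ⟨Set.mem_insert _ _, ?_⟩
      rintro x (rfl | ⟨l, h1, h2, -⟩)
      · rfl
      · omega
    · right
      exact Set.insert_eq_of_mem ⟨n, hkn, le_rfl, 1,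
        ((hS n le_rfl).above 0).one_mem' (Nat.zero_le k) hkn.le, 1,
        hT.one_mem' hkn (by omega), by simp⟩
  have hPad : P ⊆ admissible A B (n + 1) T k := by
    rintro x (rfl | ⟨l, h1, h2, t, ht, g, hg, rfl⟩)
    · rcases hk.eq_or_lt with rfl | hkn
      · rw [hA.mem_admissible_iff]
        refine ⟨hA.one_mem _, k + 1, by omega, le_rfl, ⟨1, by rw [hT.top]; rfl, fun a ha => ?_⟩,
          fun m h1 h2 => by omega⟩
        simpa using hA.subset_innerBlock (Nat.lt_succ_self k) ha
      · have h1 : (1 : G) ∈ S n k := ((hS n le_rfl).above 0).one_mem' (Nat.zero_le k) hkn.le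
        simpa using copy_mem_admissible hA hS hT hTC hkn le_rfl h1
          (hT.one_mem' hkn (by omega))
    · exact copy_mem_admissible hA hS hT hTC h1 h2 ht hg
  have hPsp : IsSpaced (A k) P := by
    rw [isSpaced_iff]
    rcases hPor with h | h
    · rw [h]; rintro g rfl h rfl _ _ _; rfl
    · rw [h]
      rintro _ ⟨l, h1, h2, t, ht, g, hg, rfl⟩ _ ⟨l', h1', h2', t', ht', g', hg', rfl⟩ x hx hx'
      rcases le_total l l' with hll | hll
      · exact copy_eq_copy hA hS hC hT hTC h1 hll h2' ht hg ht' hg' hx hx'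
      · exact (copy_eq_copy hA hS hC hT hTC h1' hll h2 ht' hg' ht hg hx' hx).symm
  obtain ⟨V, hPV, hV⟩ := exists_maximal_isSpaced hPad hPsp
  refine ⟨Function.update T k V, ⟨?_, ?_, ?_⟩, ?_⟩
  · rw [Function.update_of_ne (by omega)]; exact hT.top
  · intro j hj hjn
    rcases hj.eq_or_lt with rfl | hj
    · rw [Function.update_self]; exact hPV (Set.mem_insert _ _)
    · rw [Function.update_of_ne (by omega)]; exact hT.one_mem j hj hjn
  · intro j hj hjn
    have e : admissible A B (n + 1) (Function.update T k V) j = admissible A B (n + 1) T j :=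
      admissible_congr fun l hl => Function.update_of_ne (by omega) _ _
    rw [e]
    rcases hj.eq_or_lt with rfl | hj
    · rw [Function.update_self]; exact hV
    · rw [Function.update_of_ne (by omega)]; exact hT.maximal j hj hjn
  · intro l hl j hjl hkj g hg t
    rcases hkj.eq_or_lt with rfl | hkj
    · rw [Function.update_self]
      rcases hjl.eq_or_lt with rfl | hjl
      · rw [Function.update_self] at hg
        rw [(hS _ hl).top]
        constructor
        · rintro rfl
          exact ⟨by simpa using hg, hA.one_mem _⟩
        · rintro ⟨h1, h2⟩
          have := isSpaced_iff.1 hV.prop.2 _ h1 _ hg (t * g) (by simpa using hA.one_mem _)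
            (by simpa using h2)
          simpa using this
      · rw [Function.update_of_ne (by omega)] at hg
        have hSl := (hS l hl).above 0
        constructor
        · intro ht
          exact ⟨hPV (Or.inr ⟨l, hjl, hl, t, ht, g, hg, rfl⟩),
            hSl.subset hA (Nat.zero_le k) hjl.le ht⟩
        -- A point t * g of V in the tile at g: t is admissible in `S l`, so by maximality its tile
        -- meets that of some s in `S l k`; as s * g also lies in V, spacing gives t = s.
        · rintro ⟨h1, h2⟩
          have hadm : t ∈ admissible A B l (S l) k := by
            have := hV.prop.1 h1
            rw [hA.mem_admissible_iff] at this ⊢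
            obtain ⟨-, l', hkl', hl'n, ⟨h', hh', Hin⟩, Hout⟩ := this
            have hl'l : l' ≤ l := by
              by_contra hcon
              exact Hout l hjl (by omega) g hg 1 (hA.one_mem k) (by simpa using h2)
            have h3 : h' * g⁻¹ ∈ A l := by
              refine hT.nested hA hkl' hl'l (by omega) hh' hg (x := t * g) ?_ (by simpa using h2)
                (by simpa using hA.one_mem l')
              have := hA.innerBlock_subset hkl'.le (Hin 1 (hA.one_mem k))
              simpa using this
            refine ⟨h2, l', hkl', hl'l, ⟨h' * g⁻¹, ?_, fun a ha => ?_⟩, ?_⟩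
            · exact (hTC l hl l' hl'l hkl' g hg _).2 ⟨by simpa using hh', h3⟩
            · simpa [mul_assoc] using Hin a ha
            · intro m hkm hml' h hh a ha
              have := (hTC l hl m (by omega) hkm g hg h).1 hh
              simpa [mul_assoc] using Hout m hkm hml' _ this.1 a ha
          obtain ⟨s, hs, x, hx, hxs⟩ := hSl.exists_of_admissible hA (Nat.zero_le k) hjl hadm
          have hsg : s * g ∈ V := hPV (Or.inr ⟨l, hjl, hl, s, hs, g, hg, rfl⟩)
          have := isSpaced_iff.1 hV.prop.2 _ h1 _ hsg (x * g) (by simpa [mul_assoc] using hx)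
            (by simpa [mul_assoc] using hxs)
          rw [mul_right_cancel this]; exact hs
    · rw [Function.update_of_ne (by omega)] at hg ⊢
      exact hTC l hl j hjl hkj g hg t

theorem exists_extension :
    ∃ T, IsSystem A B (n + 1) T ∧ HasCopies A S n T 0 := by
  have key : ∀ d k, k + d = n + 1 →
      ∃ T, IsSystemAbove A B (n + 1) T k ∧ HasCopies A S n T k := by
    intro d
    induction d with
    | zero =>
      intro k hk
      exact ⟨fun _ => {1}, ⟨rfl, fun j h1 h2 => by omega, fun j h1 h2 => by omega⟩,
        fun l h1 k' h2 h3 => by omega⟩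
    | succ d ih =>
      intro k hk
      obtain ⟨T, h1, h2⟩ := ih (k + 1) (by omega)
      exact exists_level hA hS hC (by omega) h1 h2
  obtain ⟨T, h1, h2⟩ := key (n + 1) 0 (by omega)
  exact ⟨T, ⟨h1.top, fun k => h1.one_mem k (Nat.zero_le k),
    fun k => h1.maximal k (Nat.zero_le k)⟩, h2⟩

end Coherent

/-- Dependent choice in which each condition may look at the whole past; since `Q n` ignores entries
beyond n, later choices cannot spoil it. -/
theorem exists_seq_of_exists_next {α : Type*} [Inhabited α] (Q : ℕ → (ℕ → α) → Prop)
    (hQ : ∀ n s t, (∀ j ≤ n, s j = t j) → Q n s → Q n t)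
    (h : ∀ n s, (∀ j < n, Q j s) → ∃ a, Q n (Function.update s n a)) : ∃ s, ∀ n, Q n s := by
  classical
  have h' : ∀ n s, ∃ a, (∀ j < n, Q j s) → Q n (Function.update s n a) := by
    intro n s
    by_cases hs : ∀ j < n, Q j s
    · obtain ⟨a, ha⟩ := h n s hs
      exact ⟨a, fun _ => ha⟩
    · exact ⟨default, fun H => absurd H hs⟩
  choose a ha using h'
  let s : ℕ → α := fun n => Nat.strongRec (motive := fun _ => α)
    (fun n ih => a n fun j => if hj : j < n then ih j hj else default) n
  have hs : ∀ n, s n = a n fun j => if j < n then s j else default := by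
    intro n
    change Nat.strongRec (motive := fun _ => α) _ n = _
    rw [Nat.strongRec_eq]
    simp [s]
  refine ⟨s, fun n => ?_⟩
  induction n using Nat.strong_induction_on with
  | _ n ih =>
    have := ha n (fun j => if j < n then s j else default) fun j hj =>
      hQ j s _ (fun i hi => by simp [show i < n by omega]) (ih j hj)
    refine hQ n _ s (fun j hj => ?_) this
    rcases hj.eq_or_lt with rfl | hj
    · rw [Function.update_self, ← hs]
    · rw [Function.update_of_ne (by omega)]; simp [hj]

theorem HasCopies.of_le {G : Type*} [Group G] {A B : ℕ → Set G} (hA : IsBlockExhaustion A B)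
    {S : ℕ → ℕ → Set G} {n : ℕ} {T : ℕ → Set G} (hT : IsSystem A B n T) (hST : S n = T)
    (h : ∀ m < n, HasCopies A S m T 0) : HasCopies A S n T 0 := by
  intro l hl k hk _ g hg t
  rcases hl.eq_or_lt with rfl | hl
  · rw [hT.top] at hg
    obtain rfl := hg
    rw [hST, mul_one]
    exact ⟨fun ht => ⟨ht, (hT.above 0).subset hA (Nat.zero_le k) hk ht⟩, fun ht => ht.1⟩
  · exact h l hl l le_rfl k hk (Nat.zero_le k) g hg t

theorem HasCopies.congr {G : Type*} [Group G] {A : ℕ → Set G} {S S' : ℕ → ℕ → Set G} {n : ℕ}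
    {T : ℕ → Set G} {k : ℕ} (h : HasCopies A S n T k) (hS : ∀ j ≤ n, S j = S' j) :
    HasCopies A S' n T k := by
  intro l hl k hk h₀ g hg t
  rw [← hS l hl]
  exact h l hl k hk h₀ g hg t

theorem exists_isCoherent {G : Type*} [Group G] {A B : ℕ → Set G} (hA : IsBlockExhaustion A B) :
    ∃ S, IsCoherent A B S := by
  obtain ⟨S, hS⟩ := exists_seq_of_exists_next
    (fun n (S : ℕ → ℕ → Set G) => IsSystem A B n (S n) ∧ HasCopies A S n (S n) 0)
    (by
      rintro n s t hst ⟨h1, h2⟩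
      rw [← hst n le_rfl]
      exact ⟨h1, h2.congr hst⟩)
    (by
      intro n S hS
      suffices ∃ T, IsSystem A B n T ∧ ∀ m < n, HasCopies A S m T 0 by
        obtain ⟨T, h1, h2⟩ := this
        refine ⟨T, ?_⟩
        rw [Function.update_self]
        refine ⟨h1, HasCopies.of_le hA h1 (Function.update_self _ _ _) fun m hm => ?_⟩
        exact (h2 m hm).congr fun j hj => (Function.update_of_ne (by omega) _ _).symm
      cases n with
      | zero =>
        exact ⟨fun _ => {1}, ⟨rfl, fun k hk => by omega, fun k hk => by omega⟩,
          fun m hm => by omega⟩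
      | succ n =>
        obtain ⟨T, h1, h2⟩ := exists_extension hA (n := n) (S := S) (fun j hj => (hS j (by omega)).1)
          (fun j hj => (hS j (by omega)).2)
        exact ⟨T, h1, fun m hm l hl => h2 l (by omega)⟩)
  exact ⟨S, IsCoherent.of_hasCopies (fun n => (hS n).1) fun n => (hS n).2⟩

/-! ### Syndeticity and number of centres; fast-growing exhaustions -/

section Syndetic

variable {G : Type*} [Group G]

theorem IsExhaustion.exists_subset {K : Type*} [Group K] {A : ℕ → Set K} (hA : IsExhaustion A)
    {F : Set K} (hF : F.Finite) : ∃ n, ∀ m, n ≤ m → F ⊆ A m := by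
  induction F, hF using Set.Finite.induction_on with
  | empty => exact ⟨0, fun m _ => Set.empty_subset _⟩
  | @insert a s _ _ ih =>
    obtain ⟨n, hn⟩ := ih
    have ha : a ∈ ⋃ n, A n := by rw [hA.iUnion_eq]; trivial
    obtain ⟨i, hi⟩ := Set.mem_iUnion.1 ha
    exact ⟨max n i, fun m hm => Set.insert_subset (hA.mono (le_trans (le_max_right _ _) hm) hi)
      (hn m (le_trans (le_max_left _ _) hm))⟩

/-- If no tile of intermediate level is met, g is admissible with witness l, and maximality provides
a nearby centre. -/
theorem IsSystem.exists_near_or_meets {A B : ℕ → Set G} (hA : IsBlockExhaustion A B) {n : ℕ}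
    {S : ℕ → Set G} (hS : IsSystem A B n S) {k l : ℕ} (hkl : k < l) (hln : l ≤ n) {g h : G}
    (hh : h ∈ S l) (hg : ∀ a ∈ A k, a * g * h⁻¹ ∈ innerBlock A B l k) :
    (∃ c ∈ A k * A k, c * g ∈ S k) ∨
      ∃ l', k < l' ∧ l' < l ∧ ∃ h' ∈ S l', ∃ a ∈ A k, a * g * h'⁻¹ ∈ A l' := by
  by_cases hout : ∃ l', k < l' ∧ l' < l ∧ ∃ h' ∈ S l', ∃ a ∈ A k, a * g * h'⁻¹ ∈ A l'
  · exact Or.inr hout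
  · left
    push Not at hout
    have hS0 := hS.above 0
    have hgn : g ∈ A n := hS0.tile_subset hA (Nat.zero_le l) hln hh (by
      simpa using hA.innerBlock_subset hkl.le (hg 1 (hA.one_mem k)))
    obtain ⟨s, hs, x, hx, hxs⟩ := hS0.exists_of_admissible hA (Nat.zero_le k) (by omega)
      (hA.mem_admissible_iff.2 ⟨hgn, l, hkl, hln, ⟨h, hh, hg⟩, hout⟩)
    exact ⟨(x * s⁻¹)⁻¹ * (x * g⁻¹), ⟨_, hA.inv_mem hxs, _, hx, rfl⟩, by simpa [mul_assoc] using hs⟩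

/-- The sets `S_N(k)` are syndetic in `A_N`, uniformly in `N`. -/
theorem IsCoherent.exists_syndetic {A B : ℕ → Set G} (hA : IsBlockExhaustion A B)
    {S : ℕ → ℕ → Set G} (hS : IsCoherent A B S) (k : ℕ) : ∃ K : Set G, K.Finite ∧
      ∀ N, k < N → ∀ g ∈ A N, ∃ c ∈ K, c * g ∈ S N k := by
  obtain ⟨R, hR, hRin⟩ := hA.exists_finite_shift k
  have hAf := hA.exhaustion.finite
  have fin2 : (A k * R * A k * R).Finite := (((hAf k).mul hR).mul (hAf k)).mul hR
  -- L is chosen so that A_L undoes every displacement made in the two rounds below.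
  obtain ⟨L, hL⟩ := hA.exhaustion.exists_subset fin2.inv
  have hQ := hL L le_rfl
  refine ⟨(A k * A k * R ∪ A k * A k * R * A k * R) ∪ (A L * A k * R ∪ A L * A k * R * A k * R),
    ?_, ?_⟩
  · refine (Set.Finite.union ?_ ?_).union (Set.Finite.union ?_ ?_)
    · exact ((hAf k).mul (hAf k)).mul hR
    · exact ((((hAf k).mul (hAf k)).mul hR).mul (hAf k)).mul hR
    · exact ((hAf L).mul (hAf k)).mul hR
    · exact ((((hAf L).mul (hAf k)).mul hR).mul (hAf k)).mul hR
  intro N hkN g hg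
  have hSN := (hS.system N).above 0
  -- the centre of a tile of bounded level near `g`
  have centre : ∀ l, k < l → l ≤ L → l ≤ N → ∀ h ∈ S N l, ∀ z, z * h⁻¹ ∈ A l →
      (z * h⁻¹)⁻¹ ∈ A L ∧ (z * h⁻¹)⁻¹ * z ∈ S N k := by
    intro l hkl hlL hlN h hh z hz
    refine ⟨hA.exhaustion.mono hlL (hA.inv_mem hz), ?_⟩
    have h1 : (1 : G) ∈ S l k := (hS.system l).one_mem k hkl
    have := ((hS.hasCopies N l hlN k hkl.le (Nat.zero_le k) h hh 1).1 h1).1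
    simpa using this
  have shift : ∀ l, k < l → ∀ x h : G, x * h⁻¹ ∈ A l → ∃ r ∈ R, ∀ a ∈ A k,
      a * (r * x) * h⁻¹ ∈ innerBlock A B l k := by
    intro l hkl x h hx
    obtain ⟨r, hr, hrin⟩ := hRin l hkl _ hx
    exact ⟨r, hr, fun a ha => by simpa [mul_assoc] using hA.mul_mem_innerBlock hkl ha hrin⟩
  have hex : ∃ l, k < l ∧ l ≤ N ∧ ∃ h ∈ S N l, g * h⁻¹ ∈ A l :=
    ⟨N, hkN, le_rfl, 1, by rw [(hS.system N).top]; rfl, by simpa using hg⟩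
  classical
  -- Among the levels above k having a tile that contains g, take the least.
  obtain ⟨hkl, hlN, h, hh, hgh⟩ := Nat.find_spec hex
  have hmin := fun l => Nat.find_min hex (m := l)
  set l := Nat.find hex
  obtain ⟨r₁, hr₁, H₁⟩ := shift l hkl g h hgh
  rcases (hS.system N).exists_near_or_meets hA hkl hlN hh H₁ with
    ⟨c, hc, hcS⟩ | ⟨l₁, hkl₁, hl₁, h₁, hh₁, a₁, ha₁, hm₁⟩
  · exact ⟨c * r₁, Or.inl (Or.inl ⟨c, hc, r₁, hr₁, rfl⟩), by rwa [mul_assoc]⟩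
  -- A tile of level at most L has its centre within A_L, and that centre belongs to `S N k` because
  -- `S l₁ k` contains 1. Otherwise a second round is played inside the tile at h₁.
  by_cases hL₁ : l₁ ≤ L
  · obtain ⟨hd, hdS⟩ := centre l₁ hkl₁ hL₁ (by omega) h₁ hh₁ _ hm₁
    exact ⟨_, Or.inr (Or.inl ⟨_, ⟨_, hd, a₁, ha₁, rfl⟩, r₁, hr₁, rfl⟩),
      by simpa only [mul_assoc] using hdS⟩
  obtain ⟨r₂, hr₂, H₂⟩ := shift l₁ hkl₁ _ h₁ hm₁
  rcases (hS.system N).exists_near_or_meets hA hkl₁ (by omega) hh₁ H₂ with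
    ⟨c, hc, hcS⟩ | ⟨l₂, hkl₂, hl₂, h₂, hh₂, a₂, ha₂, hm₂⟩
  · exact ⟨c * r₂ * a₁ * r₁, Or.inl (Or.inr ⟨_, ⟨_, ⟨c, hc, r₂, hr₂, rfl⟩, a₁, ha₁, rfl⟩,
      r₁, hr₁, rfl⟩), by simpa only [mul_assoc] using hcS⟩
  by_cases hL₂ : l₂ ≤ L
  · obtain ⟨hd, hdS⟩ := centre l₂ hkl₂ hL₂ (by omega) h₂ hh₂ _ hm₂
    exact ⟨_, Or.inr (Or.inr ⟨_, ⟨_, ⟨_, ⟨_, hd, a₂, ha₂, rfl⟩, r₂, hr₂, rfl⟩, a₁, ha₁, rfl⟩,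
      r₁, hr₁, rfl⟩), by simpa only [mul_assoc] using hdS⟩
  -- Now L < l₂ < l₁, so the tile at h₁ contains the A_L-collar of the tile at h₂, and with it g.
  -- This contradicts the minimality of l.
  exfalso
  refine hmin l₁ hl₁ ⟨hkl₁, by omega, h₁, hh₁, ?_⟩
  have hq : (a₂ * r₂ * a₁ * r₁)⁻¹ ∈ A L := hQ (Set.inv_mem_inv.2
    ⟨_, ⟨_, ⟨a₂, ha₂, r₂, hr₂, rfl⟩, a₁, ha₁, rfl⟩, r₁, hr₁, rfl⟩)
  have := hSN.nested_deep hA (Nat.zero_le l₂) (by omega) hl₂ (by omega) hh₂ hh₁ hm₂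
    (hA.innerBlock_subset hkl₁.le (H₂ a₂ ha₂)) hq hm₂
  simpa [mul_assoc] using this

theorem outerCentres_succ_self (A : ℕ → Set G) (S : ℕ → ℕ → Set G) (n : ℕ) :
    outerCentres A S (n + 1) n = S (n + 1) n := by
  unfold outerCentres
  rw [sdiff_eq_left, Set.disjoint_left]
  intro x _ hx
  simp only [Set.mem_iUnion] at hx
  obtain ⟨m, ⟨h1, h2⟩, -⟩ := hx
  omega

/-- No level lies strictly between n and n + 1, so each b ∈ B_{n+1} must be within A_n A_n of a
centre. -/
theorem IsSystem.ncard_le {A B : ℕ → Set G} (hA : IsBlockExhaustion A B) {n : ℕ} {S : ℕ → Set G}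
    (hS : IsSystem A B (n + 1) S) :
    (B (n + 1)).ncard ≤ (A n).ncard * (A n).ncard * (S n).ncard := by
  have hS0 := hS.above 0
  have hsub : B (n + 1) ⊆ A n * A n * S n := by
    intro b hb
    obtain ⟨c, hc, hcS⟩ | ⟨l', h1, h2, -⟩ := hS.exists_near_or_meets hA (Nat.lt_succ_self n)
      le_rfl (g := b) (h := 1) (by rw [hS.top]; rfl) (by
        intro a ha
        rw [inv_one, mul_one]
        exact hA.mul_mem_innerBlock (Nat.lt_succ_self n) ha (by rwa [innerBlock_self]))
    · obtain ⟨x, hx, y, hy, rfl⟩ := hc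
      exact ⟨y⁻¹ * x⁻¹, ⟨_, hA.inv_mem hy, _, hA.inv_mem hx, rfl⟩, _, hcS, by
        change y⁻¹ * x⁻¹ * (x * y * b) = b
        group⟩
    · omega
  have hSf : (S n).Finite :=
    (hA.exhaustion.finite _).subset (hS0.subset hA (Nat.zero_le n) (Nat.le_succ n))
  have hAf := hA.exhaustion.finite n
  calc (B (n + 1)).ncard ≤ (A n * A n * S n).ncard :=
        Set.ncard_le_ncard hsub ((hAf.mul hAf).mul hSf)
    _ ≤ (A n * A n).ncard * (S n).ncard := Set.natCard_mul_le
    _ ≤ _ := Nat.mul_le_mul_right _ Set.natCard_mul_le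

theorem exists_finite_symm_superset {K : Type*} [Group K] [Infinite K] {F : Set K} (hF : F.Finite)
    (c : ℕ) : ∃ E : Set K, F ⊆ E ∧ E.Finite ∧ E⁻¹ = E ∧ 1 ∈ E ∧ c < E.ncard := by
  obtain ⟨T, hT⟩ := Set.infinite_univ (α := K) |>.exists_subset_card_eq (c + 1)
  set E : Set K := insert 1 ((F ∪ T) ∪ (F ∪ T)⁻¹) with hE
  have hfin : E.Finite := ((hF.union T.finite_toSet).union (hF.union T.finite_toSet).inv).insert 1
  refine ⟨E, fun x hx => Or.inr (Or.inl (Or.inl hx)), hfin, ?_, Set.mem_insert _ _, ?_⟩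
  · rw [hE, Set.inv_insert, Set.union_inv, inv_inv, inv_one, Set.union_comm]
  · have : (T : Set K).ncard ≤ E.ncard :=
      Set.ncard_le_ncard (fun x hx => Or.inr (Or.inl (Or.inr hx))) hfin
    rw [Set.ncard_coe_finset, hT.2] at this
    omega

/-- In a countably infinite group there are block exhaustions whose last factors grow as fast as
desired. -/
theorem exists_isBlockExhaustion (G : Type*) [Group G] [Countable G] [Infinite G]
    (f : ℕ → ℕ → ℕ) : ∃ A B : ℕ → Set G, IsBlockExhaustion A B ∧ (∀ n, (B n).Finite) ∧
      ∀ n, f n (A n).ncard < (B (n + 1)).ncard := by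
  obtain ⟨e, he⟩ := exists_surjective_nat G
  have hE : ∀ n c, ∃ E : Set G, e '' Set.Iic n ⊆ E ∧ E.Finite ∧ E⁻¹ = E ∧ 1 ∈ E ∧ c < E.ncard :=
    fun n c => exists_finite_symm_superset ((Set.finite_Iic n).image e) c
  choose E hE1 hE2 hE3 hE4 hE5 using hE
  -- the pairs `(A_0 ^ 3 ⋯ A_{n-1} ^ 3, E_n)`
  let s : ℕ → Set G × Set G := fun n => Nat.rec (1, E 0 0)
    (fun n p => (p.1 * (p.1 * p.2 * p.1⁻¹) ^ 3, E (n + 1) (f n (p.1 * p.2 * p.1⁻¹).ncard))) n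
  -- The shape P E P⁻¹ with E symmetric makes A_n symmetric; the trailing P⁻¹ is absorbed into B_n.
  -- As E_{n+1} is chosen after A_n, its size may depend on |A_n|.
  let A : ℕ → Set G := fun n => (s n).1 * (s n).2 * (s n).1⁻¹
  let B : ℕ → Set G := fun n => (s n).2 * (s n).1⁻¹
  have hs1 : ∀ n, (s (n + 1)).1 = (s n).1 * A n ^ 3 := fun n => rfl
  have hs2 : ∀ n, (s (n + 1)).2 = E (n + 1) (f n (A n).ncard) := fun n => rfl
  have hsE : ∀ n, ∃ c, (s n).2 = E n c := by
    intro n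
    cases n with
    | zero => exact ⟨0, rfl⟩
    | succ n => exact ⟨_, hs2 n⟩
  have hprod : ∀ n, (s n).1 = ((List.Ico 0 n).map fun i => A i ^ 3).prod := by
    intro n
    induction n with
    | zero => simp [s]
    | succ n ih =>
      rw [hs1, ih, List.Ico.succ_top (Nat.zero_le n), List.map_append, List.prod_append]
      simp
  have fin1 : ∀ n, (s n).1.Finite := by
    intro n
    induction n with
    | zero => exact Set.finite_one
    | succ n ih =>
      obtain ⟨c, hc⟩ := hsE n
      have hAn : (A n).Finite := (ih.mul (hc ▸ hE2 n c)).mul ih.inv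
      rw [hs1, pow_succ, pow_two]
      exact ih.mul ((hAn.mul hAn).mul hAn)
  have fin2 : ∀ n, (s n).2.Finite := by
    intro n; obtain ⟨c, hc⟩ := hsE n; rw [hc]; exact hE2 n c
  have one2 : ∀ n, (1 : G) ∈ (s n).2 := by
    intro n; obtain ⟨c, hc⟩ := hsE n; rw [hc]; exact hE4 n c
  have oneA : ∀ n, (1 : G) ∈ (s n).1 → (1 : G) ∈ A n := fun n h =>
    ⟨1, ⟨1, h, 1, one2 n, mul_one 1⟩, 1, by simpa using h, mul_one 1⟩
  have one1 : ∀ n, (1 : G) ∈ (s n).1 := by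
    intro n
    induction n with
    | zero => exact Set.one_mem_one
    | succ n ih =>
      rw [hs1]
      exact ⟨1, ih, 1, Set.one_mem_pow (oneA n ih), mul_one 1⟩
  have one1' : ∀ n, (1 : G) ∈ (s n).1⁻¹ := fun n => by simpa using one1 n
  refine ⟨A, B, ⟨⟨?_, ?_, ?_, ?_, ?_⟩, ?_, ?_⟩, ?_, ?_⟩
  · refine monotone_nat_of_le_succ fun n a ha => ?_
    refine ⟨a, ⟨a, ?_, 1, one2 (n + 1), mul_one a⟩, 1, one1' (n + 1), mul_one a⟩
    rw [hs1]
    refine ⟨1, one1 n, a, ?_, one_mul a⟩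
    exact Set.subset_pow (oneA n (one1 n)) (by norm_num) ha
  · refine Set.eq_univ_of_forall fun g => ?_
    obtain ⟨n, rfl⟩ := he g
    refine Set.mem_iUnion.2 ⟨n, ⟨e n, ⟨1, one1 n, e n, ?_, one_mul _⟩, 1, one1' n, mul_one _⟩⟩
    obtain ⟨c, hc⟩ := hsE n
    rw [hc]
    exact hE1 n c ⟨n, Set.mem_Iic.2 le_rfl, rfl⟩
  · exact fun n => ((fin1 n).mul (fin2 n)).mul (fin1 n).inv
  · intro n
    obtain ⟨c, hc⟩ := hsE n
    simp only [A]
    rw [mul_inv_rev, mul_inv_rev, inv_inv, hc, hE3, mul_assoc]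
  · exact fun n => oneA n (one1 n)
  · exact fun n => ⟨1, one2 n, 1, one1' n, mul_one 1⟩
  · intro n
    rw [innerBlock, ← hprod]
    exact mul_assoc _ _ _
  · exact fun n => (fin2 n).mul (fin1 n).inv
  · intro n
    refine lt_of_lt_of_le (hE5 (n + 1) (f n (A n).ncard)) ?_
    rw [← hs2]
    exact Set.ncard_le_ncard (fun x hx => ⟨x, hx, 1, one1' (n + 1), mul_one x⟩)
      ((fin2 (n + 1)).mul (fin1 (n + 1)).inv)

end Syndetic

/-! ### Irreducibility and greedy colourings -/

section Irreducibility

variable {H α : Type*} [Group H]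

instance FullShift.instCompactSpace [TopologicalSpace α] [CompactSpace α] :
    CompactSpace (FullShift H α) :=
  inferInstanceAs (CompactSpace (H → α))

instance FullShift.instT2Space [TopologicalSpace α] [T2Space α] : T2Space (FullShift H α) :=
  inferInstanceAs (T2Space (H → α))

omit [Group H] in
theorem FullShift.continuous_eval [TopologicalSpace α] (h : H) :
    Continuous fun x : FullShift H α => x h :=
  continuous_apply h

theorem isApart_iff {D S T : Set H} :
    IsApart D S T ↔ ∀ d ∈ D, ∀ s ∈ S, ∀ d' ∈ D, ∀ t ∈ T, d * s ≠ d' * t := by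
  unfold IsApart
  rw [Set.disjoint_left]
  constructor
  · intro h d hd s hs d' hd' t ht e
    exact h ⟨d, hd, s, hs, rfl⟩ ⟨d', hd', t, ht, e.symm⟩
  · rintro h _ ⟨d, hd, s, hs, rfl⟩ ⟨d', hd', t, ht, e⟩
    exact h d hd s hs d' hd' t ht e.symm

theorem IsApart.symm {D S T : Set H} (h : IsApart D S T) : IsApart D T S := Disjoint.symm h

theorem IsIrreducibleWith.mono {D D' : Set H} (hD : D ⊆ D') {X : Set (FullShift H α)}
    (h : IsIrreducibleWith D X) : IsIrreducibleWith D' X := fun S₀ S₁ hS =>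
  h S₀ S₁ (Disjoint.mono (Set.mul_subset_mul_right hD) (Set.mul_subset_mul_right hD) hS)

theorem pattern_smul_apply (C : Set H) (h : H) (x : FullShift H α) (c : C) :
    pattern C (h • x) c = x (c * h) := rfl

section Family

variable [TopologicalSpace α] [CompactSpace α] [T2Space α] {D : Set H} {X : Set (FullShift H α)}

/-- In a closed irreducible set, any family of pairwise apart partial configurations can be
realized simultaneously. -/
theorem IsIrreducibleWith.exists_family (hirr : IsIrreducibleWith D X) (hX : IsClosed X)
    (hne : X.Nonempty) {ι : Type*} (S : ι → Set H) (x : ι → FullShift H α) (hx : ∀ i, x i ∈ X)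
    (hS : ∀ i j, i ≠ j → IsApart D (S i) (S j)) : ∃ y ∈ X, ∀ i, ∀ s ∈ S i, y s = x i s := by
  classical
  have hfin : ∀ u : Finset ι, ∃ y ∈ X, ∀ i ∈ u, ∀ s ∈ S i, y s = x i s := by
    intro u
    induction u using Finset.induction_on with
    | empty =>
      obtain ⟨y, hy⟩ := hne
      exact ⟨y, hy, by simp⟩
    | insert a u ha ih =>
      obtain ⟨y, hy, hyu⟩ := ih
      obtain ⟨z, hz, hz0, hz1⟩ := hirr (⋃ i ∈ u, S i) (S a) (by
        rw [isApart_iff]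
        intro d hd s hs d' hd' t ht
        simp only [Set.mem_iUnion] at hs
        obtain ⟨i, hi, hs⟩ := hs
        exact isApart_iff.1 (hS i a (by rintro rfl; exact ha hi)) d hd s hs d' hd' t ht)
        y hy (x a) (hx a)
      refine ⟨z, hz, fun i hi s hs => ?_⟩
      rcases Finset.mem_insert.1 hi with rfl | hi
      · exact hz1 s hs
      · rw [hz0 s (Set.mem_biUnion hi hs)]; exact hyu i hi s hs
  -- Compactness passes from finite subfamilies to the whole family.
  obtain ⟨y, hy, hyi⟩ := hX.isCompact.inter_iInter_nonempty
    (fun i => {y : FullShift H α | ∀ s ∈ S i, y s = x i s})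
    (fun i => by
      simp only [Set.ofPred_forall]
      exact isClosed_biInter fun s _ =>
        isClosed_eq (FullShift.continuous_eval s) continuous_const)
    (fun u => by
      obtain ⟨y, hy, hyu⟩ := hfin u
      exact ⟨y, hy, Set.mem_iInter₂.2 hyu⟩)
  exact ⟨y, hy, fun i => Set.mem_iInter.1 hyi i⟩

end Family

/-- Greedy colouring: a partial spaced partition extends to a spaced partition. -/
theorem exists_spacedPartition_extend {E : Set H} (hE : E.Finite) (hne : E.Nonempty) (S : Set H)
    (γ₀ : H → Fin (E⁻¹ * E).ncard)
    (hγ₀ : ∀ g ∈ S, ∀ h ∈ S, γ₀ g = γ₀ h → ∀ x, x * g⁻¹ ∈ E → x * h⁻¹ ∈ E → g = h) :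
    ∃ γ ∈ spacedPartitions E (E⁻¹ * E).ncard, ∀ h ∈ S, γ h = γ₀ h := by
  classical
  have hfin : (E⁻¹ * E).Finite := hE.inv.mul hE
  -- Any g in conflict with h has g h⁻¹ ∈ E⁻¹E ∖ {1}, so at most |E⁻¹E| − 1 colours are forbidden.
  have hcol : ∀ (f : H → Fin (E⁻¹ * E).ncard) (h : H), ∃ c, ∀ g, g ≠ h →
      ∀ x, x * g⁻¹ ∈ E → x * h⁻¹ ∈ E → f g ≠ c := by
    intro f h
    by_contra! hcon
    have hone : (1 : H) ∈ E⁻¹ * E := by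
      obtain ⟨e, he⟩ := hne
      exact ⟨e⁻¹, Set.inv_mem_inv.2 he, e, he, inv_mul_cancel e⟩
    have hsub : (Set.univ : Set (Fin (E⁻¹ * E).ncard)) ⊆
        (fun u => f (u * h)) '' ((E⁻¹ * E) \ {1}) := by
      intro c _
      obtain ⟨g, hg, x, hxg, hxh, rfl⟩ := hcon c
      refine ⟨g * h⁻¹, ⟨⟨(x * g⁻¹)⁻¹, Set.inv_mem_inv.2 hxg, _, hxh, ?_⟩, ?_⟩, ?_⟩
      · change (x * g⁻¹)⁻¹ * (x * h⁻¹) = g * h⁻¹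
        group
      · intro e
        exact hg (mul_inv_eq_one.1 e)
      · simp
    have h1 := (Set.ncard_le_ncard hsub (hfin.sdiff.image _)).trans
      (Set.ncard_image_le hfin.sdiff)
    have h2 := Set.ncard_sdiff_singleton_lt_of_mem hone hfin
    rw [Set.ncard_univ, Nat.card_fin] at h1
    omega
  choose col hcol using hcol
  let r : H → H → Prop := WellOrderingRel
  have hwf : WellFounded r := IsWellFounded.wf
  have hN : 0 < (E⁻¹ * E).ncard := by
    obtain ⟨h⟩ : Nonempty H := ⟨1⟩
    exact (col γ₀ h).pos
  let γ : H → Fin (E⁻¹ * E).ncard := hwf.fix fun h ih =>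
    if h ∈ S then γ₀ h else
      col (fun g => if g ∈ S then γ₀ g else if hg : r g h then ih g hg else ⟨0, hN⟩) h
  have hγ : ∀ h, γ h = if h ∈ S then γ₀ h else
      col (fun g => if g ∈ S then γ₀ g else if r g h then γ g else ⟨0, hN⟩) h := by
    intro h
    change hwf.fix _ h = _
    rw [hwf.fix_eq]
    rfl
  have hS : ∀ h ∈ S, γ h = γ₀ h := fun h hh => by rw [hγ, if_pos hh]
  have key : ∀ g h, g ≠ h → h ∉ S → (g ∈ S ∨ r g h) → ∀ x, x * g⁻¹ ∈ E → x * h⁻¹ ∈ E →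
      γ g ≠ γ h := by
    intro g h hne hh hgh x hxg hxh
    rw [hγ h, if_neg hh]
    have := hcol (fun g => if g ∈ S then γ₀ g else if r g h then γ g else ⟨0, hN⟩) h g hne x hxg hxh
    by_cases hg : g ∈ S
    · rw [if_pos hg] at this
      rwa [hS g hg]
    · rwa [if_neg hg, if_pos (hgh.resolve_left hg)] at this
  refine ⟨γ, fun k => ?_, hS⟩
  rw [isSpaced_iff]
  intro g hg h hh x hxg hxh
  have hgh : γ g = γ h := Eq.trans hg (Eq.symm hh)
  by_contra hne
  by_cases hgS : g ∈ S
  · by_cases hhS : h ∈ S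
    · rw [hS g hgS, hS h hhS] at hgh
      exact hne (hγ₀ g hgS h hhS hgh x hxg hxh)
    · exact key g h hne hhS (Or.inl hgS) x hxg hxh hgh
  · by_cases hhS : h ∈ S
    · exact key h g (Ne.symm hne) hgS (Or.inl hhS) x hxh hxg hgh.symm
    · rcases trichotomous_of r g h with hlt | heq | hlt
      · exact key g h hne hhS (Or.inr hlt) x hxg hxh hgh
      · exact hne heq
      · exact key h g (Ne.symm hne) hgS (Or.inr hlt) x hxh hxg hgh.symm

/-! ### Printing tuples -/

section Print

variable [TopologicalSpace α] [CompactSpace α] [T2Space α] {D C : Set H} {X : Set (FullShift H α)}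
  {p : C → α}

theorem isClosed_spacedPartitions (E : Set H) (N : ℕ) :
    IsClosed (spacedPartitions E N : Set (FullShift H (Fin N))) := by
  have : spacedPartitions E N = ⋂ k : Fin N, ⋂ g : H, ⋂ h : H,
      {γ : FullShift H (Fin N) | γ g = k → γ h = k → g ≠ h → IsApart E {g} {h}} := by
    ext γ
    simp only [spacedPartitions, IsSpaced, Set.mem_ofPred_eq, Set.mem_iInter]
    exact ⟨fun H k g h hg hh => H k g hg h hh, fun H k g hg h hh => H k g h hg hh⟩
  rw [this]
  refine isClosed_iInter fun k => isClosed_iInter fun g => isClosed_iInter fun h => ?_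
  have hc : Continuous fun γ : FullShift H (Fin N) => (γ g, γ h) :=
    (FullShift.continuous_eval g).prodMk (FullShift.continuous_eval h)
  exact (isClosed_discrete
    {q : Fin N × Fin N | q.1 = k → q.2 = k → g ≠ h → IsApart E {g} {h}}).preimage hc

-- The partition ranges over a compact space, so projecting the closed set of pairs (tuple,
-- partition) gives a closed set.
omit [CompactSpace α] in
theorem isClosed_Print (hX : IsClosed X) : IsClosed (Print D C X p) := by
  set N := printCard D C with hN
  set Z : Set ((Fin N → FullShift H α) × FullShift H (Fin N)) :=
    {z | z.2 ∈ spacedPartitions (D * C) N ∧ ∀ h, pattern C (h • z.1 (z.2 h)) = p} with hZ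
  have hZc : IsClosed Z := by
    have : Z = (Prod.snd ⁻¹' spacedPartitions (D * C) N) ∩
        ⋂ h : H, ⋂ i : Fin N, ⋂ c : C,
          {z : (Fin N → FullShift H α) × FullShift H (Fin N) | z.2 h = i → z.1 i (c * h) = p c} := by
      ext z
      simp only [hZ, Set.mem_ofPred_eq, Set.mem_inter_iff, Set.mem_preimage, Set.mem_iInter,
        funext_iff, pattern_smul_apply]
      refine and_congr_right fun _ => forall_congr' fun h => ?_
      exact ⟨fun H i c hi => hi ▸ H c, fun H c => H _ c rfl⟩
    rw [this]
    refine ((isClosed_spacedPartitions _ _).preimage continuous_snd).inter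
      (isClosed_iInter fun h => isClosed_iInter fun i => isClosed_iInter fun c => ?_)
    have h1 : IsClosed {z : (Fin N → FullShift H α) × FullShift H (Fin N) |
        z.1 i ((c : H) * h) = p c} :=
      isClosed_eq ((FullShift.continuous_eval _).comp ((continuous_apply i).comp continuous_fst))
        continuous_const
    have h2 : IsClosed {z : (Fin N → FullShift H α) × FullShift H (Fin N) | ¬ z.2 h = i} :=
      (isClosed_discrete {j : Fin N | ¬ j = i}).preimage
        ((FullShift.continuous_eval h).comp continuous_snd)
    have := h2.union h1
    convert this using 1
    ext z
    simp only [Set.mem_ofPred_eq, Set.mem_union]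
    tauto
  have e : Print D C X p = (⋂ i, {x | x i ∈ X}) ∩ Prod.fst '' Z := by
    ext x
    simp only [Print, Set.mem_ofPred_eq, Set.mem_inter_iff, Set.mem_iInter, Set.mem_image]
    refine and_congr_right fun _ => ⟨?_, ?_⟩
    · rintro ⟨γ, h1, h2⟩
      exact ⟨(x, γ), ⟨h1, h2⟩, rfl⟩
    · rintro ⟨⟨x', γ⟩, ⟨h1, h2⟩, rfl⟩
      exact ⟨γ, h1, h2⟩
  rw [e]
  exact (isClosed_iInter fun i => hX.preimage (continuous_apply i)).inter
    (isClosedMap_fst_of_compactSpace _ hZc)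

/-- One coordinate of a printing tuple, extending a given partial configuration. -/
theorem exists_print_coord (hirr : IsIrreducibleWith D X) (hX : IsClosed X)
    (hinv : ∀ h : H, ∀ x ∈ X, h • x ∈ X) (hp : p ∈ patterns C X) {N : ℕ}
    {γ : FullShift H (Fin N)} (hγ : γ ∈ spacedPartitions (D * C) N) (i : Fin N) (T : Set H)
    {z : FullShift H α} (hz : z ∈ X)
    (hT : ∀ h, γ h = i → (pattern C (h • z) = p ∧ ∀ c ∈ C, c * h ∈ T) ∨ IsApart D T (C * {h})) :
    ∃ y ∈ X, (∀ t ∈ T, y t = z t) ∧ ∀ h, γ h = i → pattern C (h • y) = p := by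
  obtain ⟨x₀, hx₀, rfl⟩ := hp
  -- `none` keeps z on T, and each remaining h asks for a copy of p on C h. These sets C h are
  -- D-apart since the class of colour i is DC-spaced.
  let ι := Option {h : H // γ h = i ∧ IsApart D T (C * {h})}
  let S : ι → Set H := fun o => o.elim T fun h => C * {h.1}
  let x : ι → FullShift H α := fun o => o.elim z fun h => h.1⁻¹ • x₀
  obtain ⟨y, hy, hyS⟩ := hirr.exists_family hX ⟨z, hz⟩ S x (by
      rintro (_ | h)
      · exact hz
      · exact hinv _ _ hx₀) (by
      rintro (_ | ⟨g, hg, hgT⟩) (_ | ⟨h, hh, hhT⟩) hne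
      · exact absurd rfl hne
      · exact hhT
      · exact hgT.symm
      · change IsApart D (C * {g}) (C * {h})
        have hgh : g ≠ h := by rintro rfl; exact hne rfl
        have := hγ i g hg h hh hgh
        unfold IsApart at this ⊢
        rwa [mul_assoc, mul_assoc] at this)
  refine ⟨y, hy, hyS none, fun h hh => ?_⟩
  rcases hT h hh with ⟨h1, h2⟩ | h1
  · rw [← h1]
    funext c
    exact hyS none _ (h2 c c.2)
  · funext c
    have := hyS (some ⟨h, hh, h1⟩) (c * h) ⟨c, c.2, h, rfl, rfl⟩
    rw [pattern_smul_apply, this]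
    change x₀ (c * h * h⁻¹) = x₀ c
    rw [mul_inv_cancel_right]

theorem Print_nonempty (hirr : IsIrreducibleWith D X) (hX : IsClosed X)
    (hinv : ∀ h : H, ∀ x ∈ X, h • x ∈ X) (hp : p ∈ patterns C X) (hfin : (D * C).Finite)
    (hne : (D * C).Nonempty) : (Print D C X p).Nonempty := by
  have hN : 0 < printCard D C := by
    obtain ⟨e, he⟩ := hne
    exact (Set.ncard_pos (hfin.inv.mul hfin)).2 ⟨e⁻¹ * e, e⁻¹, Set.inv_mem_inv.2 he, e, he, rfl⟩
  obtain ⟨γ, hγ, -⟩ := exists_spacedPartition_extend hfin hne ∅ (fun _ => ⟨0, hN⟩) (by simp)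
  have hX0 : X.Nonempty := by
    obtain ⟨x, hx, -⟩ := hp
    exact ⟨x, hx⟩
  obtain ⟨z, hz⟩ := hX0
  have := fun i => exists_print_coord hirr hX hinv hp hγ i ∅ hz
    (fun h _ => Or.inr (by rw [isApart_iff]; simp))
  choose y hy _ hyp using this
  exact ⟨y, hy, γ, hγ, fun h => hyp _ h rfl⟩

/-- The set of printing tuples is strongly irreducible. -/
theorem Print_irreducible (hirr : IsIrreducibleWith D X) (hX : IsClosed X)
    (hinv : ∀ h : H, ∀ x ∈ X, h • x ∈ X) (hp : p ∈ patterns C X) (hfin : (D * C).Finite)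
    (hne : (D * C).Nonempty) {S₀ S₁ : Set H} (hS : IsApart (D * C * (D * C)⁻¹ * D) S₀ S₁)
    {x x' : Fin (printCard D C) → FullShift H α} (hx : x ∈ Print D C X p)
    (hx' : x' ∈ Print D C X p) :
    ∃ y ∈ Print D C X p, ∀ i, (∀ s ∈ S₀, y i s = x i s) ∧ ∀ s ∈ S₁, y i s = x' i s := by
  classical
  obtain ⟨hxX, γ, hγ, hγx⟩ := hx
  obtain ⟨hxX', γ', hγ', hγx'⟩ := hx'
  -- R S consists of the positions whose copy of p could interfere with S; only there is the old
  -- colour retained. The hypothesis on S₀ and S₁ makes DC·R S₀ and DC·R S₁ disjoint, so the two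
  -- colourings do not conflict.
  let R : Set H → Set H := fun S => {h | ∃ e ∈ D * C, ∃ d ∈ D, ∃ s ∈ S, e * h = d * s}
  have hR : ∀ h ∈ R S₀, ∀ h' ∈ R S₁, ∀ e ∈ D * C, ∀ e' ∈ D * C, e * h ≠ e' * h' := by
    rintro h ⟨f, hf, d, hd, s, hs, e1⟩ h' ⟨f', hf', d', hd', s', hs', e2⟩ e he e' he' heq
    refine isApart_iff.1 hS (e * f⁻¹ * d) ⟨_, ⟨e, he, f⁻¹, Set.inv_mem_inv.2 hf, rfl⟩, d, hd, rfl⟩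
      s hs (e' * f'⁻¹ * d') ⟨_, ⟨e', he', f'⁻¹, Set.inv_mem_inv.2 hf', rfl⟩, d', hd', rfl⟩ s' hs' ?_
    rw [mul_assoc, ← e1, mul_assoc (e' * f'⁻¹), ← e2]
    simpa [mul_assoc] using heq
  have hdisj : ∀ h ∈ R S₀, h ∉ R S₁ := fun h h0 h1 => by
    obtain ⟨e, he⟩ := hne
    exact hR h h0 h h1 e he e he rfl
  have hsp : ∀ {γ : FullShift H (Fin (printCard D C))},
      γ ∈ spacedPartitions (D * C) (printCard D C) → ∀ g h, γ g = γ h →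
      ∀ x, x * g⁻¹ ∈ D * C → x * h⁻¹ ∈ D * C → g = h := fun hγ g h hgh x h1 h2 =>
    isSpaced_iff.1 (hγ _) g hgh h rfl x h1 h2
  obtain ⟨δ, hδ, hδγ⟩ := exists_spacedPartition_extend hfin hne (R S₀ ∪ R S₁)
    (fun h => if h ∈ R S₀ then γ h else γ' h) (by
      have main : ∀ g ∈ R S₀, ∀ h ∈ R S₁, ∀ x, x * g⁻¹ ∈ D * C → x * h⁻¹ ∈ D * C → False :=
        fun g hg h hh x h1 h2 => hR g hg h hh _ h1 _ h2 (by simp)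
      rintro g (hg | hg) h (hh | hh) hgh x h1 h2
      · exact hsp hγ g h (((if_pos hg).symm.trans hgh).trans (if_pos hh)) x h1 h2
      · exact (main g hg h hh x h1 h2).elim
      · exact (main h hh g hg x h2 h1).elim
      · exact hsp hγ' g h (((if_neg fun h0 => hdisj g h0 hg).symm.trans hgh).trans
          (if_neg fun h0 => hdisj h h0 hh)) x h1 h2)
  have hδ0 : ∀ h ∈ R S₀, δ h = γ h := fun h hh =>
    (hδγ h (Or.inl hh)).trans (if_pos hh)
  have hδ1 : ∀ h ∈ R S₁, δ h = γ' h := fun h hh =>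
    (hδγ h (Or.inr hh)).trans (if_neg fun h0 => hdisj h h0 hh)
  have coord : ∀ i, ∃ y ∈ X, ((∀ s ∈ S₀, y s = x i s) ∧ ∀ s ∈ S₁, y s = x' i s) ∧
      ∀ h, δ h = i → pattern C (h • y) = p := by
    intro i
    -- Besides S, the already printed copies of p near S must be preserved.
    let T : Set H → Set H := fun S => S ∪ {t | ∃ c ∈ C, ∃ h ∈ R S, δ h = i ∧ t = c * h}
    have hTR : ∀ S, ∀ t ∈ T S, ∀ d ∈ D, ∃ h ∈ R S, ∃ e ∈ D * C, d * t = e * h := by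
      rintro S t (ht | ⟨c, hc, h, hh, -, rfl⟩) d hd
      · obtain ⟨e, he⟩ := hne
        exact ⟨e⁻¹ * (d * t), ⟨e, he, d, hd, t, ht, by simp⟩, e, he, by simp⟩
      · exact ⟨h, hh, d * c, ⟨d, hd, c, hc, rfl⟩, (mul_assoc _ _ _).symm⟩
    obtain ⟨z, hz, hz0, hz1⟩ := hirr (T S₀) (T S₁) (by
      rw [isApart_iff]
      intro d hd t ht d' hd' t' ht' heq
      obtain ⟨h, hh, e, he, e1⟩ := hTR S₀ t ht d hd
      obtain ⟨h', hh', e', he', e2⟩ := hTR S₁ t' ht' d' hd'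
      exact hR h hh h' hh' e he e' he' (by rw [← e1, ← e2, heq])) (x i) (hxX i) (x' i) (hxX' i)
    obtain ⟨y, hy, hyT, hyp⟩ := exists_print_coord hirr hX hinv hp hδ i (T S₀ ∪ T S₁) hz (by
      intro h hh
      by_cases h0 : h ∈ R S₀
      · left
        have hT0 : ∀ c ∈ C, c * h ∈ T S₀ := fun c hc => Or.inr ⟨c, hc, h, h0, hh, rfl⟩
        refine ⟨?_, fun c hc => Or.inl (hT0 c hc)⟩
        rw [← hγx h, ← hδ0 h h0, hh]
        funext c
        exact hz0 _ (hT0 c c.2)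
      by_cases h1 : h ∈ R S₁
      · left
        have hT1 : ∀ c ∈ C, c * h ∈ T S₁ := fun c hc => Or.inr ⟨c, hc, h, h1, hh, rfl⟩
        refine ⟨?_, fun c hc => Or.inr (hT1 c hc)⟩
        rw [← hγx' h, ← hδ1 h h1, hh]
        funext c
        exact hz1 _ (hT1 c c.2)
      right
      have aux : ∀ S, h ∉ R S → ∀ d ∈ D, ∀ t ∈ T S, ∀ d' ∈ D, ∀ c ∈ C, d * t ≠ d' * (c * h) := by
        rintro S hS d hd t (ht | ⟨c', hc', h', hh', hi, rfl⟩) d' hd' c hc heq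
        · exact hS ⟨d' * c, ⟨d', hd', c, hc, rfl⟩, d, hd, t, ht, by rw [mul_assoc, heq]⟩
        · have : h' = h := hsp hδ h' h (hi.trans hh.symm) (d * (c' * h'))
            ⟨d, hd, c', hc', by simp [mul_assoc]⟩
            (by rw [heq]; exact ⟨d', hd', c, hc, by simp [mul_assoc]⟩)
          exact hS (this ▸ hh')
      rw [isApart_iff]
      rintro d hd t (ht | ht) d' hd' _ ⟨c, hc, _, rfl, rfl⟩
      · exact aux S₀ h0 d hd t ht d' hd' c hc
      · exact aux S₁ h1 d hd t ht d' hd' c hc)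
    refine ⟨y, hy, ⟨fun s hs => ?_, fun s hs => ?_⟩, hyp⟩
    · rw [hyT s (Or.inl (Or.inl hs)), hz0 s (Or.inl hs)]
    · rw [hyT s (Or.inr (Or.inl hs)), hz1 s (Or.inl hs)]
  choose y hy hyS hyp using coord
  exact ⟨y, ⟨hy, δ, hδ, fun h => hyp _ h rfl⟩, hyS⟩

end Print

end Irreducibility

/-! ### Translated restrictions -/

section Window

variable {G H : Type*} [Group G] [Group H]

omit [Group H] in
theorem window_apply {E F : Set G} {g : G} {y : FullShift H (E → Bool)} {h : H} {a : F}
    (ha : (a : G) * g ∈ E) : window E F g y h a = y h ⟨a * g, ha⟩ :=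
  dif_pos ha

omit [Group H] in
theorem window_one_apply {E F : Set G} (hFE : F ⊆ E) {y : FullShift H (E → Bool)} {h : H} {a : F} :
    window E F 1 y h a = y h ⟨a, hFE a.2⟩ := by
  rw [window_apply (by simpa using hFE a.2)]
  congr 1
  exact Subtype.ext (mul_one _)

omit [Group H] in
theorem continuous_window (E F : Set G) (g : G) :
    Continuous (window (H := H) E F g) := by
  refine continuous_pi fun h => continuous_pi fun a => ?_
  by_cases ha : (a : G) * g ∈ E
  · have : (fun y : FullShift H (E → Bool) => window E F g y h a) = fun y => y h ⟨a * g, ha⟩ :=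
      funext fun y => dif_pos ha
    change Continuous fun y : FullShift H (E → Bool) => window E F g y h a
    rw [this]
    exact (continuous_apply (A := fun _ : E => Bool) _).comp (FullShift.continuous_eval h)
  · have : (fun y : FullShift H (E → Bool) => window E F g y h a) = fun _ => false :=
      funext fun y => dif_neg ha
    change Continuous fun y : FullShift H (E → Bool) => window E F g y h a
    rw [this]
    exact continuous_const

omit [Group H] in
theorem window_window {E F F' : Set G} {g g' : G} {y : FullShift H (E → Bool)}
    (h1 : ∀ a ∈ F', a * g' ∈ F) (h2 : ∀ a ∈ F, a * g ∈ E) :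
    window F F' g' (window E F g y) = window E F' (g' * g) y := by
  funext h a
  rw [window_apply (h1 a a.2), window_apply (h2 _ (h1 a a.2)),
    window_apply (by rw [← mul_assoc]; exact h2 _ (h1 a a.2))]
  congr 1
  exact Subtype.ext (mul_assoc _ _ _)

end Window

/-! ### One step of the construction -/

section NextSet

variable {G H : Type*} [Group G] [Group H] {A B : ℕ → Set G} {S : ℕ → ℕ → Set G}

/-- The set `Y_{n+1}` determined by `Y_0, …, Y_n` and the choices at stage `n`. -/
def nextSet (A : ℕ → Set G) (S : ℕ → ℕ → Set G) (n : ℕ) (Y : ∀ k, Set (FullShift H (A k → Bool)))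
    (D C : Set H) (F : patterns C (Y n) → Fin (printCard D C) → G) :
    Set (FullShift H (A (n + 1) → Bool)) :=
  {y | (∀ k < n, ∀ g ∈ outerCentres A S (n + 1) k, window (A (n + 1)) (A k) g y ∈ Y k) ∧
    (∀ g ∈ outerCentres A S (n + 1) n, (∀ p j, F p j ≠ g) →
      window (A (n + 1)) (A n) g y ∈ Y n) ∧
    ∀ p : patterns C (Y n), (fun j => window (A (n + 1)) (A n) (F p j) y) ∈
      Print D C (Y n) p.1}

/-- If tiles of different levels met, nesting would put the smaller centre inside the larger tile,
which outer centres avoid. -/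
theorem outerCentres_unique (hA : IsBlockExhaustion A B) {n : ℕ}
    (hS : IsSystem A B (n + 1) (S (n + 1))) {k k' : ℕ} (hk : k ≤ n) (hk' : k' ≤ n) {g g' x : G}
    (hg : g ∈ outerCentres A S (n + 1) k) (hg' : g' ∈ outerCentres A S (n + 1) k')
    (hx : x * g⁻¹ ∈ A k) (hx' : x * g'⁻¹ ∈ A k') : k = k' ∧ g = g' := by
  have hS0 := hS.above 0
  have aux : ∀ k k' g g', k < k' → k' ≤ n → g ∈ outerCentres A S (n + 1) k →
      g' ∈ outerCentres A S (n + 1) k' → x * g⁻¹ ∈ A k → x * g'⁻¹ ∈ A k' → False := by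
    intro k k' g g' hlt hk' hg hg' hx hx'
    refine hg.2 (Set.mem_iUnion₂.2 ⟨k', ⟨hlt, by omega⟩, g * g'⁻¹, ?_, g', hg'.1, by simp⟩)
    exact hS0.nested hA (Nat.zero_le k) hlt.le (by omega) hg.1 hg'.1 hx hx'
      (by simpa using hA.one_mem k)
  rcases lt_trichotomy k k' with hlt | rfl | hlt
  · exact (aux k k' g g' hlt hk' hg hg' hx hx').elim
  · exact ⟨rfl, hS0.eq_of_mem (Nat.zero_le k) (by omega) hg.1 hg'.1 hx hx'⟩
  · exact (aux k' k g' g hlt hk hg' hg hx' hx).elim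

theorem outer_tile_subset (hA : IsBlockExhaustion A B) {n : ℕ}
    (hS : IsSystem A B (n + 1) (S (n + 1))) {k : ℕ} (hk : k ≤ n) {g a : G}
    (hg : g ∈ outerCentres A S (n + 1) k) (ha : a ∈ A k) : a * g ∈ A (n + 1) :=
  (hS.above 0).tile_subset hA (Nat.zero_le k) (by omega) hg.1 (by simpa using ha)

-- Outer tiles are disjoint, so their contents can be prescribed with no compatibility condition.
omit [Group H] in
theorem exists_glue (hA : IsBlockExhaustion A B) {n : ℕ} (hS : IsSystem A B (n + 1) (S (n + 1)))
    (W : ∀ k, G → FullShift H (A k → Bool)) (z : FullShift H (A (n + 1) → Bool)) :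
    ∃ y : FullShift H (A (n + 1) → Bool),
      (∀ k ≤ n, ∀ g ∈ outerCentres A S (n + 1) k, window (A (n + 1)) (A k) g y = W k g) ∧
      ∀ h (a : A (n + 1)),
        (∀ k ≤ n, ∀ g ∈ outerCentres A S (n + 1) k, (a : G) * g⁻¹ ∉ A k) → y h a = z h a := by
  classical
  let val : ℕ × G → H → G → Bool := fun q h a =>
    if ha : a * q.2⁻¹ ∈ A q.1 then W q.1 q.2 h ⟨_, ha⟩ else false
  let R : G → ℕ × G → Prop := fun a q =>
    q.1 ≤ n ∧ q.2 ∈ outerCentres A S (n + 1) q.1 ∧ a * q.2⁻¹ ∈ A q.1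
  let y : FullShift H (A (n + 1) → Bool) := fun h a =>
    if ex : ∃ q, R a q then val ex.choose h a else z h a
  refine ⟨y, ?_, ?_⟩
  · intro k hk g hg
    funext h a
    have hag := outer_tile_subset hA hS hk hg a.2
    rw [window_apply hag]
    have hR : R (a * g) (k, g) := ⟨hk, hg, by simp⟩
    have ex : ∃ q, R (a * g) q := ⟨_, hR⟩
    have heq : ex.choose = (k, g) := by
      obtain ⟨h1, h2, h3⟩ := ex.choose_spec
      obtain ⟨e1, e2⟩ := outerCentres_unique hA hS h1 hk h2 hg h3 hR.2.2
      exact Prod.ext e1 e2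
    have e1 : y h ⟨a * g, hag⟩ = val ex.choose h (a * g) := dif_pos ex
    rw [e1, heq]
    change (if ha : (a * g : G) * g⁻¹ ∈ A k then W k g h ⟨_, ha⟩ else false) = _
    rw [dif_pos (by simp)]
    congr 1
    exact Subtype.ext (mul_inv_cancel_right _ _)
  · intro h a ha
    refine dif_neg ?_
    rintro ⟨q, h1, h2, h3⟩
    exact ha q.1 h1 q.2 h2 h3

omit [Group H] in
theorem exists_glue_enum (hA : IsBlockExhaustion A B) {n : ℕ}
    (hS : IsSystem A B (n + 1) (S (n + 1))) {P ι : Type*} {F : P → ι → G}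
    (hF : ∀ p j, F p j ∈ outerCentres A S (n + 1) n)
    (hinj : Function.Injective (Function.uncurry F))
    (W : ∀ k, G → FullShift H (A k → Bool)) (V : P → ι → FullShift H (A n → Bool))
    (z : FullShift H (A (n + 1) → Bool)) :
    ∃ y : FullShift H (A (n + 1) → Bool),
      (∀ k < n, ∀ g ∈ outerCentres A S (n + 1) k, window (A (n + 1)) (A k) g y = W k g) ∧
      (∀ g ∈ outerCentres A S (n + 1) n, (∀ p j, F p j ≠ g) →
        window (A (n + 1)) (A n) g y = W n g) ∧
      (∀ p j, window (A (n + 1)) (A n) (F p j) y = V p j) ∧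
      ∀ h (a : A (n + 1)),
        (∀ k ≤ n, ∀ g ∈ outerCentres A S (n + 1) k, (a : G) * g⁻¹ ∉ A k) → y h a = z h a := by
  classical
  obtain ⟨y, hy, hyz⟩ := exists_glue hA hS (Function.update W n fun g =>
    if hg : ∃ q : P × ι, F q.1 q.2 = g then V hg.choose.1 hg.choose.2 else W n g) z
  refine ⟨y, fun k hk g hg => ?_, fun g hg hgF => ?_, fun p j => ?_, hyz⟩
  · rw [hy k hk.le g hg, Function.update_of_ne hk.ne]
  · rw [hy n le_rfl g hg, Function.update_self, dif_neg]
    rintro ⟨q, hq⟩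
    exact hgF _ _ hq
  · have hex : ∃ q : P × ι, F q.1 q.2 = F p j := ⟨(p, j), rfl⟩
    have : hex.choose = (p, j) := hinj hex.choose_spec
    rw [hy n le_rfl _ (hF p j), Function.update_self, dif_pos hex, this]

variable {n : ℕ} {Y : ∀ k, Set (FullShift H (A k → Bool))} {D C : Set H}
  {F : patterns C (Y n) → Fin (printCard D C) → G}

theorem window_mem_of_mem_nextSet {y : FullShift H (A (n + 1) → Bool)}
    (hy : y ∈ nextSet A S n Y D C F) {k : ℕ} (hk : k ≤ n) {g : G}
    (hg : g ∈ outerCentres A S (n + 1) k) : window (A (n + 1)) (A k) g y ∈ Y k := by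
  rcases hk.eq_or_lt with rfl | hk
  · by_cases h : ∀ p j, F p j ≠ g
    · exact hy.2.1 g hg h
    · push Not at h
      obtain ⟨p, j, rfl⟩ := h
      exact (hy.2.2 p).1 j
  · exact hy.1 k hk g hg

theorem isClosed_nextSet (hY : ∀ k ≤ n, IsClosed (Y k)) : IsClosed (nextSet A S n Y D C F) := by
  have h1 : IsClosed {y : FullShift H (A (n + 1) → Bool) | ∀ k < n,
      ∀ g ∈ outerCentres A S (n + 1) k, window (A (n + 1)) (A k) g y ∈ Y k} := by
    simp only [Set.ofPred_forall]
    exact isClosed_iInter fun k => isClosed_iInter fun hk => isClosed_iInter fun g =>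
      isClosed_iInter fun _ => (hY k (le_of_lt hk)).preimage (continuous_window _ _ g)
  have h2 : IsClosed {y : FullShift H (A (n + 1) → Bool) | ∀ g ∈ outerCentres A S (n + 1) n,
      (∀ p j, F p j ≠ g) → window (A (n + 1)) (A n) g y ∈ Y n} := by
    simp only [Set.ofPred_forall]
    exact isClosed_iInter fun g => isClosed_iInter fun _ => isClosed_iInter fun _ =>
      (hY n le_rfl).preimage (continuous_window _ _ g)
  have h3 : IsClosed {y : FullShift H (A (n + 1) → Bool) | ∀ p : patterns C (Y n),
      (fun j => window (A (n + 1)) (A n) (F p j) y) ∈ Print D C (Y n) p.1} := by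
    simp only [Set.ofPred_forall]
    exact isClosed_iInter fun p => (isClosed_Print (hY n le_rfl)).preimage
      (continuous_pi fun j => continuous_window _ _ (F p j))
  exact h1.inter (h2.inter h3)

theorem smul_mem_nextSet (hY : ∀ k ≤ n, ∀ h : H, ∀ y ∈ Y k, h • y ∈ Y k) (h : H)
    {y : FullShift H (A (n + 1) → Bool)} (hy : y ∈ nextSet A S n Y D C F) :
    h • y ∈ nextSet A S n Y D C F :=
  ⟨fun k hk g hg => hY k hk.le h _ (hy.1 k hk g hg),
    fun g hg hF => hY n le_rfl h _ (hy.2.1 g hg hF),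
    fun p => smul_mem_Print (hY n le_rfl) h (hy.2.2 p)⟩

/-- The point 1 is an outer centre of level n not enumerated by F, so any y can be placed there; all
other tiles are filled arbitrarily. -/
theorem exists_mem_nextSet (hA : IsBlockExhaustion A B) (hS : IsSystem A B (n + 1) (S (n + 1)))
    (hF : ∀ p j, F p j ∈ outerCentres A S (n + 1) n) (hF1 : ∀ p j, F p j ≠ 1)
    (hinj : Function.Injective (Function.uncurry F)) (hne : ∀ k ≤ n, (Y k).Nonempty)
    (hcl : IsClosed (Y n)) (hinv : ∀ h : H, ∀ y ∈ Y n, h • y ∈ Y n)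
    (hirr : IsIrreducibleWith D (Y n)) (hfin : (D * C).Finite) (hDC : (D * C).Nonempty)
    {y : FullShift H (A n → Bool)} (hy : y ∈ Y n) :
    ∃ z ∈ nextSet A S n Y D C F, window (A (n + 1)) (A n) 1 z = y := by
  classical
  have hW : ∀ k, ∃ w : FullShift H (A k → Bool), k ≤ n → w ∈ Y k := by
    intro k
    by_cases hk : k ≤ n
    · exact ⟨(hne k hk).some, fun _ => (hne k hk).some_mem⟩
    · exact ⟨fun _ _ => false, fun h => absurd h hk⟩
  choose W hW using hW
  have hV : ∀ p : patterns C (Y n), (Print D C (Y n) p.1).Nonempty := fun p =>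
    Print_nonempty hirr hcl hinv p.2 hfin hDC
  choose V hV using hV
  obtain ⟨z, h1, h2, h3, -⟩ := exists_glue_enum hA hS hF hinj
    (Function.update (fun k _ => W k) n fun _ => y) V fun _ _ => false
  refine ⟨z, ⟨fun k hk g hg => ?_, fun g hg hgF => ?_, fun p => ?_⟩, ?_⟩
  · rw [h1 k hk g hg, Function.update_of_ne hk.ne]
    exact hW k hk.le
  · rwa [h2 g hg hgF, Function.update_self]
  · simp only [h3]
    exact hV p
  · rw [h2 1 (by rw [outerCentres_succ_self]; exact hS.one_mem n (Nat.lt_succ_self n)) hF1,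
      Function.update_self]

/-- The set is a product, so interpolation is done factor by factor: jointly on the tiles printing
the same p, separately on every other tile and off the tiles. -/
theorem nextSet_irreducible (hA : IsBlockExhaustion A B) (hS : IsSystem A B (n + 1) (S (n + 1)))
    (hF : ∀ p j, F p j ∈ outerCentres A S (n + 1) n)
    (hinj : Function.Injective (Function.uncurry F))
    (hcl : IsClosed (Y n)) (hinv : ∀ h : H, ∀ y ∈ Y n, h • y ∈ Y n)
    (hirr : ∀ k ≤ n, IsIrreducibleWith D (Y k)) (hfin : (D * C).Finite) (hDC : (D * C).Nonempty)
    {E : Set H} (hDE : D ⊆ E) (hE : D * C * (D * C)⁻¹ * D ⊆ E) :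
    IsIrreducibleWith E (nextSet A S n Y D C F) := by
  classical
  intro S₀ S₁ hS₀₁ y₀ hy₀ y₁ hy₁
  have hmono : ∀ {D'}, D' ⊆ E → IsApart D' S₀ S₁ := fun h =>
    Disjoint.mono (Set.mul_subset_mul_right h) (Set.mul_subset_mul_right h) hS₀₁
  have hdisj : ∀ s ∈ S₁, s ∉ S₀ := by
    obtain ⟨_, d, hd, -⟩ := hDC
    exact fun s h1 h0 => isApart_iff.1 hS₀₁ d (hDE hd) s h0 d (hDE hd) s h1 rfl
  have hW : ∀ k (g : G), ∃ w : FullShift H (A k → Bool),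
      k ≤ n → g ∈ outerCentres A S (n + 1) k → w ∈ Y k ∧
        (∀ s ∈ S₀, w s = window (A (n + 1)) (A k) g y₀ s) ∧
        ∀ s ∈ S₁, w s = window (A (n + 1)) (A k) g y₁ s := by
    intro k g
    by_cases hk : k ≤ n ∧ g ∈ outerCentres A S (n + 1) k
    · obtain ⟨w, hw, hw01⟩ := hirr k hk.1 S₀ S₁ (hmono hDE) _
        (window_mem_of_mem_nextSet hy₀ hk.1 hk.2) _ (window_mem_of_mem_nextSet hy₁ hk.1 hk.2)
      exact ⟨w, fun _ _ => ⟨hw, hw01⟩⟩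
    · exact ⟨fun _ _ => false, fun h1 h2 => absurd ⟨h1, h2⟩ hk⟩
  choose W hW using hW
  have hV := fun p : patterns C (Y n) => Print_irreducible (hirr n le_rfl) hcl hinv p.2 hfin hDC
    (hmono hE) (hy₀.2.2 p) (hy₁.2.2 p)
  choose V hV hV01 using hV
  obtain ⟨y, h1, h2, h3, h4⟩ := exists_glue_enum hA hS hF hinj W V
    fun h => if h ∈ S₀ then y₀ h else y₁ h
  refine ⟨y, ⟨fun k hk g hg => ?_, fun g hg hgF => ?_, fun p => ?_⟩, ?_⟩
  · rw [h1 k hk g hg]; exact (hW k g hk.le hg).1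
  · rw [h2 g hg hgF]; exact (hW n g le_rfl hg).1
  · simp only [h3]
    exact hV p
  -- agreement on tiles and off tiles
  have agree : ∀ (y' : FullShift H (A (n + 1) → Bool)) (s : H),
      (∀ k ≤ n, ∀ g ∈ outerCentres A S (n + 1) k, W k g s = window (A (n + 1)) (A k) g y' s) →
      (∀ p j, V p j s = window (A (n + 1)) (A n) (F p j) y' s) →
      (if s ∈ S₀ then y₀ s else y₁ s) = y' s → y s = y' s := by
    intro y' s hWs hVs hzs
    funext a
    by_cases ha : ∀ k ≤ n, ∀ g ∈ outerCentres A S (n + 1) k, (a : G) * g⁻¹ ∉ A k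
    · rw [h4 s a ha, hzs]
    · push Not at ha
      obtain ⟨k, hk, g, hg, hag⟩ := ha
      have hwin : window (A (n + 1)) (A k) g y s = window (A (n + 1)) (A k) g y' s := by
        rcases hk.eq_or_lt with rfl | hk
        · by_cases hgF : ∀ p j, F p j ≠ g
          · rw [h2 g hg hgF, hWs _ le_rfl g hg]
          · push Not at hgF
            obtain ⟨p, j, rfl⟩ := hgF
            rw [h3, hVs]
        · rw [h1 k hk g hg, hWs k hk.le g hg]
      have := congrFun hwin ⟨_, hag⟩
      rw [window_apply (by simp), window_apply (by simp)] at this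
      simpa using this
  refine ⟨fun s hs => agree y₀ s ?_ ?_ ?_, fun s hs => agree y₁ s ?_ ?_ ?_⟩
  · exact fun k hk g hg => (hW k g hk hg).2.1 s hs
  · exact fun p j => (hV01 p j).1 s hs
  · rw [if_pos hs]
  · exact fun k hk g hg => (hW k g hk hg).2.2 s hs
  · exact fun p j => (hV01 p j).2 s hs
  · rw [if_neg (hdisj s hs)]

end NextSet

/-! ### The choices can be made -/

section Existence

variable {G H : Type*} [Group G] [Group H]

-- The strict inequality leaves room for discarding 1.
omit [Group H] in
theorem exists_enumeration {P : Type*} [Finite P] {T : Set G} {q : ℕ} (hT : T.Finite)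
    (h : q * Nat.card P < T.ncard) : ∃ F : P → Fin q → G, (∀ p j, F p j ∈ T) ∧
      (∀ p j, F p j ≠ 1) ∧ Function.Injective (Function.uncurry F) := by
  classical
  have hT' : (T \ {1}).Finite := hT.sdiff
  have hcard : T.ncard - 1 ≤ (T \ {1}).ncard := by
    have := Set.ncard_le_ncard_sdiff_add_ncard T {1}
    rw [Set.ncard_singleton] at this
    omega
  have := Fintype.ofFinite P
  have : Fintype (T \ {1} : Set G) := hT'.fintype
  obtain ⟨f⟩ := Function.Embedding.nonempty_of_card_le (α := P × Fin q)
    (β := (T \ {1} : Set G)) (by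
      rw [Fintype.card_prod, Fintype.card_fin, ← Nat.card_eq_fintype_card (α := P), Nat.mul_comm,
        ← Nat.card_eq_fintype_card (α := (T \ {1} : Set G))]
      exact le_trans (by omega) hcard)
  exact ⟨fun p j => f (p, j), fun p j => (f (p, j)).2.1, fun p j => (f (p, j)).2.2,
    fun a b hab => f.injective (Subtype.ext hab)⟩

omit [Group G] [Group H] in
theorem card_patterns_le {A : Set G} {C : Set H} (hA : A.Finite) (hC : C.Finite)
    (Y : Set (FullShift H (A → Bool))) :
    Finite (patterns C Y) ∧ Nat.card (patterns C Y) ≤ 2 ^ (A.ncard * C.ncard) := by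
  classical
  have := hA.fintype
  have := hC.fintype
  have : Finite (C → A → Bool) := inferInstance
  refine ⟨inferInstance, (Nat.card_le_card_of_injective _ Subtype.val_injective).trans ?_⟩
  rw [Nat.card_fun, Nat.card_fun, Nat.card_eq_fintype_card (α := Bool), Fintype.card_bool, ← pow_mul]
  rfl

/-- The enumeration has a type depending on `Y n`, and the next set depends on all earlier ones; the
recursion therefore carries the whole sequence and changes only entry n + 1. -/
theorem exists_levels (A : ℕ → Set G) (S : ℕ → ℕ → Set G) (D C : ℕ → Set H)
    (F : ∀ n (Y : Set (FullShift H (A n → Bool))),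
      patterns (C n) Y → Fin (printCard (D n) (C n)) → G) :
    ∃ Y : ∀ n, Set (FullShift H (A n → Bool)), Y 0 = Set.univ ∧
      ∀ n, Y (n + 1) = nextSet A S n Y (D n) (C n) (F n (Y n)) := by
  classical
  let Z : ℕ → ∀ k, Set (FullShift H (A k → Bool)) := fun n => Nat.rec (fun _ => Set.univ)
    (fun n Z => Function.update Z (n + 1) (nextSet A S n Z (D n) (C n) (F n (Z n)))) n
  have hZ : ∀ n, Z (n + 1) =
    Function.update (Z n) (n + 1) (nextSet A S n (Z n) (D n) (C n) (F n (Z n n))) := fun n => rfl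
  have hle : ∀ n k, k ≤ n → Z n k = Z k k := by
    intro n k hkn
    induction n, hkn using Nat.le_induction with
    | base => rfl
    | succ n hkn ih => rw [hZ, Function.update_of_ne (by omega), ih]
  refine ⟨fun n => Z n n, rfl, fun n => ?_⟩
  change Z (n + 1) (n + 1) = nextSet A S n (fun n => Z n n) (D n) (C n) (F n (Z n n))
  rw [hZ, Function.update_self]
  ext y
  refine and_congr_left fun _ => forall₂_congr fun k hk => ?_
  rw [hle n k hk.le]

/-- The sets `Y_0, …, Y_n` are closed, non-empty, invariant and `D`-irreducible. -/
structure IsGoodLevel {α : Type*} [TopologicalSpace α] (D : Set H) (Y : Set (FullShift H α)) :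
    Prop where
  isClosed : IsClosed Y
  nonempty : Y.Nonempty
  smul_mem : ∀ h : H, ∀ y ∈ Y, h • y ∈ Y
  irreducible : IsIrreducibleWith D Y

theorem exists_construction [Countable G] [Infinite G] {C : ℕ → Set H} (hC : IsExhaustion C) :
    ∃ K : Construction G H, K.C = C := by
  classical
  -- A symmetric set containing DC(DC)⁻¹D = DCCDD, as required for printing. It depends only on C,
  -- so the number of centres needed can be imposed when A is chosen.
  let D : ℕ → Set H := fun n => Nat.rec {1} (fun n D => D * D * C n * C n * D * D) n
  have hD : ∀ n, D (n + 1) = D n * D n * C n * C n * D n * D n := fun n => rfl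
  have Dfin : ∀ n, (D n).Finite := by
    intro n
    induction n with
    | zero => exact Set.finite_singleton 1
    | succ n ih =>
      rw [hD]
      exact ((((ih.mul ih).mul (hC.finite n)).mul (hC.finite n)).mul ih).mul ih
  have Dsymm : ∀ n, (D n)⁻¹ = D n := by
    intro n
    induction n with
    | zero => change ({1} : Set H)⁻¹ = {1}; simp
    | succ n ih =>
      rw [hD]
      simp only [mul_inv_rev, ih, hC.symm, mul_assoc]
  have Done : ∀ n, (1 : H) ∈ D n := by
    intro n
    induction n with
    | zero => rfl
    | succ n ih =>
      have hc := hC.one_mem n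
      rw [hD]
      exact ⟨1, ⟨1, ⟨1, ⟨1, ⟨1, ih, 1, ih, mul_one 1⟩, 1, hc, mul_one 1⟩, 1, hc, mul_one 1⟩,
        1, ih, mul_one 1⟩, 1, ih, mul_one 1⟩
  have hDE : ∀ n, D n ⊆ D (n + 1) := by
    intro n d hd
    have hc := hC.one_mem n
    have ih := Done n
    rw [hD]
    exact ⟨1, ⟨1, ⟨1, ⟨1, ⟨1, ih, 1, ih, mul_one 1⟩, 1, hc, mul_one 1⟩, 1, hc, mul_one 1⟩,
      1, ih, mul_one 1⟩, d, hd, one_mul d⟩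
  have hE : ∀ n, D n * C n * (D n * C n)⁻¹ * D n ⊆ D (n + 1) := by
    intro n
    rw [mul_inv_rev, Dsymm, hC.symm, hD, ← mul_assoc]
    refine Set.mul_subset_mul_right (Set.mul_subset_mul_right (Set.mul_subset_mul_right
      (Set.mul_subset_mul_right fun d hd => ⟨1, Done n, d, hd, one_mul d⟩)))
  obtain ⟨A, B, hA, hBfin, hcard⟩ := exists_isBlockExhaustion G fun n c =>
    c * c * (printCard (D n) (C n) * 2 ^ (c * (C n).ncard))
  obtain ⟨S, hS⟩ := exists_isCoherent hA
  have hScard : ∀ n, printCard (D n) (C n) * 2 ^ ((A n).ncard * (C n).ncard) <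
      (outerCentres A S (n + 1) n).ncard := by
    intro n
    rw [outerCentres_succ_self]
    -- Cancel |A_n|² from |A_n|²·(number needed) < |B_{n+1}| ≤ |A_n|²·|S_{n+1}(n)|.
    exact lt_of_mul_lt_mul_left ((hcard n).trans_le ((hS.system (n + 1)).ncard_le hA))
      (Nat.zero_le _)
  have hF : ∀ n (Y : Set (FullShift H (A n → Bool))),
      ∃ F : patterns (C n) Y → Fin (printCard (D n) (C n)) → G,
        (∀ p j, F p j ∈ outerCentres A S (n + 1) n) ∧ (∀ p j, F p j ≠ 1) ∧
        Function.Injective (Function.uncurry F) := by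
    intro n Y
    obtain ⟨h1, h2⟩ := card_patterns_le (hA.exhaustion.finite n) (hC.finite n) Y
    refine exists_enumeration ?_ (lt_of_le_of_lt (Nat.mul_le_mul_left _ h2) (hScard n))
    rw [outerCentres_succ_self]
    exact (hA.exhaustion.finite (n + 1)).subset
      (((hS.system (n + 1)).above 0).subset hA (Nat.zero_le n) (Nat.le_succ n))
  choose F hF1 hF2 hF3 using hF
  obtain ⟨Y, hY0, hY⟩ := exists_levels A S D C F
  have hDC : ∀ n, (D n * C n).Nonempty := fun n => ⟨1, 1, Done n, 1, hC.one_mem n, mul_one 1⟩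
  have hgood : ∀ n, ∀ k ≤ n, IsGoodLevel (D n) (Y k) := by
    intro n
    induction n with
    | zero =>
      intro k hk
      obtain rfl := Nat.le_zero.1 hk
      rw [hY0]
      refine ⟨isClosed_univ, ⟨fun _ _ => false, trivial⟩, fun _ _ _ => trivial, ?_⟩
      intro S₀ S₁ hS₀₁ x₀ _ x₁ _
      refine ⟨fun h => if h ∈ S₀ then x₀ h else x₁ h, trivial, fun s hs => if_pos hs,
        fun s hs => if_neg fun h0 => ?_⟩
      exact isApart_iff.1 hS₀₁ 1 rfl s h0 1 rfl s hs rfl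
    | succ n ih =>
      intro k hk
      rcases hk.eq_or_lt with rfl | hk
      · have hn := ih n le_rfl
        have hfin := (Dfin n).mul (hC.finite n)
        rw [hY]
        refine ⟨isClosed_nextSet fun k hk => (ih k hk).isClosed, ?_,
          fun h y => smul_mem_nextSet (fun k hk => (ih k hk).smul_mem) h, ?_⟩
        · obtain ⟨y, hy⟩ := hn.nonempty
          obtain ⟨z, hz, -⟩ := exists_mem_nextSet hA (hS.system (n + 1)) (hF1 n (Y n))
            (hF2 n (Y n)) (hF3 n (Y n)) (fun k hk => (ih k hk).nonempty) hn.isClosed hn.smul_mem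
            hn.irreducible hfin (hDC n) hy
          exact ⟨z, hz⟩
        · exact nextSet_irreducible hA (hS.system (n + 1)) (hF1 n (Y n)) (hF3 n (Y n)) hn.isClosed
            hn.smul_mem (fun k hk => (ih k hk).irreducible) hfin (hDC n) (hDE n) (hE n)
      · have := ih k (by omega)
        exact ⟨this.isClosed, this.nonempty, this.smul_mem, this.irreducible.mono (hDE n)⟩
  exact ⟨{
    A := A
    B := B
    S := S
    C := C
    Y := Y
    D := D
    F := fun n => F n (Y n)
    exhaustion_A := hA.exhaustion
    finite_B := hBfin
    one_mem_B := hA.one_mem_B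
    A_eq := hA.eq_innerBlock
    coherent := hS
    exhaustion_C := hC
    D_zero := rfl
    finite_D := Dfin
    symm_D := Dsymm
    irreducible := fun n k hk => (hgood n k hk).irreducible
    card_lt := hScard
    F_mem := fun n => hF1 n (Y n)
    F_ne_one := fun n => hF2 n (Y n)
    F_injective := fun n => hF3 n (Y n)
    Y_zero := hY0
    Y_succ := hY }, rfl⟩

end Existence

theorem IsExhaustion.exists_cylinder_subset {G H : Type*} [Group G] [Group H]
    {A : ℕ → Set G} {C : ℕ → Set H} (hA : IsExhaustion A) (hC : IsExhaustion C)
    {U : Set (FullShift (G × H) Bool)} (hU : IsOpen U) {y : FullShift (G × H) Bool} (hy : y ∈ U) :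
    ∃ n, ∀ x : FullShift (G × H) Bool, (∀ a ∈ A n, ∀ c ∈ C n, x (a, c) = y (a, c)) → x ∈ U := by
  obtain ⟨I, u, hu, hIU⟩ := isOpen_pi_iff.1 hU y hy
  obtain ⟨n, hn⟩ := hA.exists_subset (I.finite_toSet.image Prod.fst)
  obtain ⟨m, hm⟩ := hC.exists_subset (I.finite_toSet.image Prod.snd)
  refine ⟨max n m, fun x hx => hIU fun i hi => ?_⟩
  have : x i = y i := hx i.1 (hn _ (le_max_left _ _) ⟨i, hi, rfl⟩) i.2
    (hm _ (le_max_right _ _) ⟨i, hi, rfl⟩)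
  rw [this]
  exact (hu i hi).2

/-! ### Properties of an arbitrary construction: the levels and their limit -/

namespace Construction

variable {G H : Type*} [Group G] [Group H] (K : Construction G H)

theorem isBlockExhaustion : IsBlockExhaustion K.A K.B :=
  ⟨K.exhaustion_A, K.one_mem_B, K.A_eq⟩

theorem isSystemAbove (n : ℕ) : IsSystemAbove K.A K.B n (K.S n) 0 :=
  (K.coherent.system n).above 0

/-- With `D n` empty, {1} would be apart from itself, and irreducibility of the full shift `Y 0`
would give one point two different values at 1. -/
theorem D_nonempty (n : ℕ) : (K.D n).Nonempty := by
  rw [Set.nonempty_iff_ne_empty]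
  intro hD
  obtain ⟨y, -, h0, h1⟩ := K.irreducible n 0 (Nat.zero_le n) {1} {1}
    (by rw [isApart_iff, hD]; simp) (fun _ _ => false) (by rw [K.Y_zero]; trivial)
    (fun _ _ => true) (by rw [K.Y_zero]; trivial)
  have := (congrFun (h0 1 rfl) ⟨1, K.exhaustion_A.one_mem 0⟩).symm.trans
    (congrFun (h1 1 rfl) ⟨1, K.exhaustion_A.one_mem 0⟩)
  simp at this

theorem finite_DC (n : ℕ) : (K.D n * K.C n).Finite :=
  (K.finite_D n).mul (K.exhaustion_C.finite n)

theorem DC_nonempty (n : ℕ) : (K.D n * K.C n).Nonempty :=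
  (K.D_nonempty n).mul ⟨1, K.exhaustion_C.one_mem n⟩

theorem Y_succ_eq (n : ℕ) :
    K.Y (n + 1) = nextSet K.A K.S n K.Y (K.D n) (K.C n) (K.F n) :=
  K.Y_succ n

theorem isClosed_Y (n : ℕ) : IsClosed (K.Y n) := by
  induction n using Nat.strong_induction_on with
  | _ n ih =>
    cases n with
    | zero => rw [K.Y_zero]; exact isClosed_univ
    | succ n =>
      rw [K.Y_succ_eq]
      exact isClosed_nextSet fun k hk => ih k (by omega)

/-- Non-emptiness is kept as a hypothesis because it is itself proved by induction from this lift.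
-/
theorem exists_lift_of_nonempty {n : ℕ} (hne : ∀ k ≤ n, (K.Y k).Nonempty)
    {y : FullShift H (K.A n → Bool)} (hy : y ∈ K.Y n) :
    ∃ z ∈ K.Y (n + 1), window (K.A (n + 1)) (K.A n) 1 z = y := by
  rw [K.Y_succ_eq]
  exact exists_mem_nextSet K.isBlockExhaustion (K.coherent.system (n + 1)) (K.F_mem n)
    (K.F_ne_one n) (K.F_injective n) hne (K.isClosed_Y n) (K.smul_mem_Y n)
    (K.irreducible n n le_rfl) (K.finite_DC n) (K.DC_nonempty n) hy

theorem Y_nonempty (n : ℕ) : (K.Y n).Nonempty := by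
  induction n using Nat.strong_induction_on with
  | _ n ih =>
    cases n with
    | zero => rw [K.Y_zero]; exact ⟨fun _ _ => false, trivial⟩
    | succ n =>
      obtain ⟨y, hy⟩ := ih n (Nat.lt_succ_self n)
      obtain ⟨z, hz, -⟩ := K.exists_lift_of_nonempty (fun k hk => ih k (by omega)) hy
      exact ⟨z, hz⟩

theorem exists_lift {n : ℕ} {y : FullShift H (K.A n → Bool)} (hy : y ∈ K.Y n) :
    ∃ z ∈ K.Y (n + 1), window (K.A (n + 1)) (K.A n) 1 z = y :=
  K.exists_lift_of_nonempty (fun k _ => K.Y_nonempty k) hy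

theorem window_one_window_one {l m n : ℕ} (hlm : l ≤ m) (hmn : m ≤ n)
    (y : FullShift H (K.A n → Bool)) :
    window (K.A m) (K.A l) 1 (window (K.A n) (K.A m) 1 y) = window (K.A n) (K.A l) 1 y := by
  rw [window_window, one_mul]
  · intro a ha; rw [mul_one]; exact K.exhaustion_A.mono hlm ha
  · intro a ha; rw [mul_one]; exact K.exhaustion_A.mono hmn ha

theorem window_one_self (n : ℕ) (y : FullShift H (K.A n → Bool)) :
    window (K.A n) (K.A n) 1 y = y := by
  funext h a
  rw [window_one_apply subset_rfl]

/-- The windows of `y ∈ Y_n` around all centres of level `m` belong to `Y_m`. -/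
theorem window_mem_Y : ∀ n m, m ≤ n → ∀ g ∈ K.S n m, ∀ y ∈ K.Y n,
    window (K.A n) (K.A m) g y ∈ K.Y m := by
  intro n
  induction n using Nat.strong_induction_on with
  | _ n ihn =>
    have key : ∀ d m, n - m = d → m ≤ n → ∀ g ∈ K.S n m, ∀ y ∈ K.Y n,
        window (K.A n) (K.A m) g y ∈ K.Y m := by
      intro d
      induction d using Nat.strong_induction_on with
      | _ d ihd =>
        intro m hd hmn g hg y hy
        rcases hmn.eq_or_lt with rfl | hlt
        · rw [(K.coherent.system m).top] at hg
          obtain rfl := hg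
          rwa [K.window_one_self]
        obtain ⟨n, rfl⟩ : ∃ n', n = n' + 1 := ⟨n - 1, by omega⟩
        -- An outer centre is covered by the definition of the next set. Otherwise g = a * h with h
        -- a centre of a level l strictly between, a ∈ `S l m` by coherence, and the window at g is
        -- the window at a of the window at h.
        by_cases hout : g ∈ outerCentres K.A K.S (n + 1) m
        · rw [K.Y_succ_eq] at hy
          exact window_mem_of_mem_nextSet hy (by omega) hout
        · have : g ∈ ⋃ l, ⋃ (_ : m < l ∧ l < n + 1), K.A l * K.S (n + 1) l := by
            by_contra hcon
            exact hout ⟨hg, hcon⟩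
          obtain ⟨l, ⟨hml, hln⟩, a, ha, h, hh, rfl⟩ := by
            simpa only [Set.mem_iUnion, exists_prop] using this
          have hS := K.isSystemAbove (n + 1)
          have h1 := ihd (n + 1 - l) (by omega) l rfl hln.le h hh y hy
          have haS : a ∈ K.S l m :=
            (K.coherent.hasCopies (n + 1) l hln.le m hml.le (Nat.zero_le m) h hh a).2 ⟨hg, ha⟩
          have h2 := ihn l hln m hml.le a haS _ h1
          rwa [window_window] at h2
          · exact fun b hb => (K.isSystemAbove l).tile_subset K.isBlockExhaustion (Nat.zero_le m)
              hml.le haS (by simpa using hb)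
          · exact fun b hb => hS.tile_subset K.isBlockExhaustion (Nat.zero_le l)
              hln.le hh (by simpa using hb)
    exact fun m => key _ m rfl

theorem window_image_Y {m n : ℕ} (h : m ≤ n) : window (K.A n) (K.A m) 1 '' K.Y n = K.Y m := by
  apply Set.Subset.antisymm
  · rintro _ ⟨y, hy, rfl⟩
    exact K.window_mem_Y n m h 1 ((K.isSystemAbove n).one_mem' (Nat.zero_le m) h) y hy
  · intro y hy
    induction n, h using Nat.le_induction with
    | base => exact ⟨y, hy, K.window_one_self m y⟩
    | succ n hmn ih =>
      obtain ⟨z, hz, rfl⟩ := ih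
      obtain ⟨w, hw, rfl⟩ := K.exists_lift hz
      exact ⟨w, hw, (K.window_one_window_one hmn (Nat.le_succ n) w).symm⟩

theorem window_proj {m n : ℕ} {g : G} (hg : ∀ a ∈ K.A m, a * g ∈ K.A n)
    (x : FullShift (G × H) Bool) (h : H) (a : K.A m) :
    window (K.A n) (K.A m) g (K.proj n x) h a = x (a * g, h) :=
  window_apply (hg a a.2)

/-- Successive lifts agree on restrictions, so each coordinate can be read off at any level that
contains it. -/
theorem exists_mem_limY (y : FullShift H (K.A 0 → Bool)) : ∃ x ∈ K.limY, K.proj 0 x = y := by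
  classical
  have hlift : ∀ n (y : FullShift H (K.A n → Bool)), ∃ z, y ∈ K.Y n →
      z ∈ K.Y (n + 1) ∧ window (K.A (n + 1)) (K.A n) 1 z = y := by
    intro n y
    by_cases hy : y ∈ K.Y n
    · obtain ⟨z, hz⟩ := K.exists_lift hy
      exact ⟨z, fun _ => hz⟩
    · exact ⟨fun _ _ => false, fun h => absurd h hy⟩
  choose L hL using hlift
  let s : ∀ n, FullShift H (K.A n → Bool) := fun n => Nat.rec y (fun n z => L n z) n
  have hs : ∀ n, s n ∈ K.Y n := by
    intro n
    induction n with
    | zero => rw [K.Y_zero]; trivial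
    | succ n ih => exact (hL n _ ih).1
  have hw : ∀ m n, m ≤ n → window (K.A n) (K.A m) 1 (s n) = s m := by
    intro m n hmn
    induction n, hmn using Nat.le_induction with
    | base => exact K.window_one_self m _
    | succ n hmn ih =>
      rw [← K.window_one_window_one hmn (Nat.le_succ n), ← ih]
      congr 1
      exact (hL n _ (hs n)).2
  have hex : ∀ a, ∃ n, a ∈ K.A n := by
    intro a
    have : a ∈ ⋃ n, K.A n := by rw [K.exhaustion_A.iUnion_eq]; trivial
    exact Set.mem_iUnion.1 this
  choose N hN using hex
  let x : FullShift (G × H) Bool := fun q => s (N q.1) q.2 ⟨q.1, hN q.1⟩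
  have hx : ∀ n, K.proj n x = s n := by
    intro n
    funext h a
    have e1 : s (max n (N a)) h ⟨a, K.exhaustion_A.mono (le_max_left _ _) a.2⟩ = s n h a := by
      rw [← hw n _ (le_max_left n (N a)),
        window_one_apply (K.exhaustion_A.mono (le_max_left n (N a)))]
    have e2 : s (max n (N a)) h ⟨a, K.exhaustion_A.mono (le_max_left _ _) a.2⟩ =
        s (N a) h ⟨a, hN a⟩ := by
      rw [← hw (N a) _ (le_max_right n (N a)),
        window_one_apply (K.exhaustion_A.mono (le_max_right n (N a)))]
    exact e2.symm.trans e1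
  exact ⟨x, fun n => by rw [hx]; exact hs n, hx 0⟩

theorem subset_X : K.orbitY ⊆ K.X := subset_closure

theorem limY_subset_X : K.limY ⊆ K.X := fun x hx =>
  K.subset_X ⟨1, x, hx, by rw [← Prod.one_eq_mk, one_smul]⟩

/-- Every pattern of `y ∈ Y` on `A_n × C_n` occurs syndetically in every element of `X`. -/
theorem exists_syndetic_occurrences {y : FullShift (G × H) Bool} (hy : y ∈ K.limY) (n : ℕ) :
    ∃ Q : Set G, Q.Finite ∧ ∀ x ∈ K.X, ∃ q ∈ Q, ∀ a ∈ K.A n, ∀ c ∈ K.C n,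
      x (a * q, c) = y (a, c) := by
  obtain ⟨R, hR, hRS⟩ := K.coherent.exists_syndetic K.isBlockExhaustion (n + 1)
  let p : patterns (K.C n) (K.Y n) := ⟨pattern (K.C n) (K.proj n y), _, hy n, rfl⟩
  have hQ : (Set.range (K.F n p) * R).Finite := (Set.finite_range _).mul hR
  refine ⟨Set.range (K.F n p) * R, hQ, ?_⟩
  -- Finiteness of the set of translations makes the condition closed, so it suffices to check it on
  -- `orbitY`.
  have hclosed : IsClosed (⋃ q ∈ Set.range (K.F n p) * R, {x : FullShift (G × H) Bool |
      ∀ a ∈ K.A n, ∀ c ∈ K.C n, x (a * q, c) = y (a, c)}) := by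
    refine hQ.isClosed_biUnion fun q _ => ?_
    simp only [Set.ofPred_forall]
    exact isClosed_biInter fun a _ => isClosed_biInter fun c _ =>
      isClosed_eq (FullShift.continuous_eval _) continuous_const
  have hsub : K.orbitY ⊆ ⋃ q ∈ Set.range (K.F n p) * R, {x : FullShift (G × H) Bool |
      ∀ a ∈ K.A n, ∀ c ∈ K.C n, x (a * q, c) = y (a, c)} := by
    rintro _ ⟨g, x, hx, rfl⟩
    obtain ⟨N, hN⟩ := K.exhaustion_A.exists_subset (Set.finite_singleton g)
    -- M is large enough for A_M to contain g, and n + 2 ensures n + 1 < M as syndeticity demands.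
    set M := max N (n + 2) with hM
    have hMn : n + 1 < M := lt_of_lt_of_le (Nat.lt_succ_self _) (le_max_right _ _)
    obtain ⟨c₀, hc₀, hc₀S⟩ := hRS M hMn g (hN M (le_max_left _ _) rfl)
    have hw := K.window_mem_Y M (n + 1) hMn.le _ hc₀S _ (hx M)
    have htile : ∀ a ∈ K.A (n + 1), a * (c₀ * g) ∈ K.A M := fun a ha =>
      (K.isSystemAbove M).tile_subset K.isBlockExhaustion (Nat.zero_le _) hMn.le hc₀S
        (by rwa [mul_inv_cancel_right])
    rw [K.Y_succ_eq] at hw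
    -- The pattern p is seen from position 1 of H around the centre of index γ 1.
    obtain ⟨-, γ, -, hγ⟩ := hw.2.2 p
    have hp := hγ 1
    rw [one_smul] at hp
    refine Set.mem_iUnion₂.2 ⟨K.F n p (γ 1) * c₀, ⟨_, ⟨_, rfl⟩, c₀, hc₀, rfl⟩, fun a ha c hc => ?_⟩
    have hF : a * K.F n p (γ 1) ∈ K.A (n + 1) :=
      outer_tile_subset K.isBlockExhaustion (K.coherent.system (n + 1)) le_rfl
        (K.F_mem n p (γ 1)) ha
    have hpa : window (K.A (n + 1)) (K.A n) (K.F n p (γ 1)) (window (K.A M) (K.A (n + 1))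
        (c₀ * g) (K.proj M x)) c ⟨a, ha⟩ = y (a, c) := congrFun (congrFun hp ⟨c, hc⟩) ⟨a, ha⟩
    rw [window_apply hF, K.window_proj htile] at hpa
    rw [← hpa]
    change x (a * (K.F n p (γ 1) * c₀) * g, c * 1) = x (a * K.F n p (γ 1) * (c₀ * g), c)
    simp only [mul_assoc, mul_one]
  intro x hx
  obtain ⟨q, hq, hqx⟩ := Set.mem_iUnion₂.1 (closure_minimal hsub hclosed hx)
  exact ⟨q, hq, hqx⟩

/-! ### Dynamics of the two commuting actions -/

theorem coe_smul_G (g : G) (x : K.X) :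
    ((g • x : K.X) : FullShift (G × H) Bool) = ((g, 1) : G × H) • (x : FullShift (G × H) Bool) :=
  rfl

theorem coe_smul_H (h : H) (x : K.X) :
    ((h • x : K.X) : FullShift (G × H) Bool) = ((1, h) : G × H) • (x : FullShift (G × H) Bool) :=
  rfl

theorem smul_smul_comm (g : G) (h : H) (x : K.X) : h • g • x = g • h • x := by
  apply Subtype.ext
  simp only [coe_smul_G, coe_smul_H, smul_smul, Prod.mk_mul_mk, one_mul, mul_one]

instance : ContinuousConstSMul G K.X :=
  ⟨fun g => ((continuous_const_smul ((g, 1) : G × H)).comp continuous_subtype_val).subtype_mk _⟩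

instance : ContinuousConstSMul H K.X :=
  ⟨fun h => ((continuous_const_smul ((1, h) : G × H)).comp continuous_subtype_val).subtype_mk _⟩

instance : CompactSpace K.X :=
  isCompact_iff_compactSpace.1 (isClosed_closure (s := K.orbitY)).isCompact

instance : Nonempty K.X := by
  obtain ⟨x, hx, -⟩ := K.exists_mem_limY fun _ _ => false
  exact ⟨⟨x, K.limY_subset_X hx⟩⟩

theorem isSubshift_X : IsSubshift (K.X : Set (FullShift (G × H) Bool)) := by
  obtain ⟨x⟩ : Nonempty K.X := inferInstance
  exact ⟨⟨x, x.2⟩, isClosed_closure, fun k x hx => K.X.smul_mem k hx⟩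

theorem isFlow_G : IsFlow G K.X := ⟨inferInstance, inferInstance, inferInstance⟩

theorem isFlow_H : IsFlow H K.X := ⟨inferInstance, inferInstance, inferInstance⟩

/-- An open set meeting `X` contains some g • y with y in the inverse limit, and translating by g
reduces to a cylinder around y, whose pattern occurs in x. -/
theorem dense_orbit (x : K.X) : Dense (MulAction.orbit G x) := by
  rw [dense_iff_inter_open]
  rintro _ ⟨V, hV, rfl⟩ ⟨z, hz⟩
  obtain ⟨_, hgV, g, y, hy, rfl⟩ := mem_closure_iff.1 (show (z : FullShift (G × H) Bool) ∈
    closure K.orbitY from z.2) V hV hz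
  obtain ⟨n, hn⟩ := K.exhaustion_A.exists_cylinder_subset K.exhaustion_C
    (hV.preimage (continuous_const_smul ((g, 1) : G × H))) hgV
  obtain ⟨Q, -, hQ⟩ := K.exists_syndetic_occurrences hy n
  obtain ⟨q, -, hq⟩ := hQ x x.2
  refine ⟨(g * q) • x, ?_, ⟨g * q, rfl⟩⟩
  have := hn (((q, 1) : G × H) • (x : FullShift (G × H) Bool)) fun a ha c hc => by
    rw [← hq a ha c hc]
    change x.1 (a * q, c * 1) = x.1 (a * q, c)
    rw [mul_one]
  change ((g * q, 1) : G × H) • (x : FullShift (G × H) Bool) ∈ V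
  have e : ((g * q, 1) : G × H) = (g, 1) * (q, 1) := by simp
  rw [e, mul_smul]
  exact this

theorem isMinimalFlow_G : IsMinimalFlow G K.X :=
  ⟨K.isFlow_G, inferInstance, K.dense_orbit⟩

/-- The indicator of 1 ∈ H is allowed in `Y 0` and extends to the inverse limit; h moves it. -/
theorem exists_smul_ne {h : H} (hh : h ≠ 1) : ∃ x : K.X, h • x ≠ x := by
  classical
  obtain ⟨x, hx, hx0⟩ := K.exists_mem_limY fun l _ => decide (l = 1)
  refine ⟨⟨x, K.limY_subset_X hx⟩, fun e => ?_⟩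
  have e' : x (1 * 1, 1 * h) = x (1, 1) := congrFun (congrArg Subtype.val e) (1, 1)
  have hv : ∀ l, x (1, l) = decide (l = 1) := fun l =>
    congrFun (congrFun hx0 l) ⟨1, K.exhaustion_A.one_mem 0⟩
  rw [one_mul, one_mul, hv, hv] at e'
  simp [hh] at e'

/-- If h fixed x, it would fix the dense G-orbit of x, hence all of `X`. Essential freeness is then
immediate, the fixed point sets being empty. -/
theorem isFreeFlow_H : IsFreeFlow H K.X := by
  refine ⟨K.isFlow_H, fun h hh x hx => ?_⟩
  have hclosed : IsClosed {z : K.X | h • z = z} :=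
    isClosed_eq (continuous_const_smul h) continuous_id
  have hsub : MulAction.orbit G x ⊆ {z : K.X | h • z = z} := by
    rintro _ ⟨g, rfl⟩
    change h • g • x = g • x
    rw [K.smul_smul_comm, hx]
  obtain ⟨z, hz⟩ := K.exists_smul_ne hh
  exact hz (closure_minimal hsub hclosed (K.dense_orbit x z))

theorem isEssentiallyFreeFlow_H : IsEssentiallyFreeFlow H K.X := by
  refine ⟨K.isFlow_H, fun h hh => ?_⟩
  have : {x : K.X | h • x = x} = ∅ :=
    Set.eq_empty_of_forall_notMem fun x hx => K.isFreeFlow_H.2 h hh x hx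
  rw [this]
  exact isNowhereDense_empty

theorem exists_embedding_centralizer :
    ∃ f : H →* flowCentralizer G K.X, Function.Injective f ∧
      ∀ (h : H) (x : K.X), (f h : K.X ≃ₜ K.X) x = h • x := by
  let f : H →* flowCentralizer G K.X :=
    { toFun := fun h => ⟨Homeomorph.smul h, fun g x => K.smul_smul_comm g h x⟩
      map_one' := by
        apply Subtype.ext
        ext1 x
        exact one_smul H x
      map_mul' := by
        intro h h'
        apply Subtype.ext
        ext1 x
        exact mul_smul h h' x }
  refine ⟨f, (injective_iff_map_eq_one f).2 fun h hf => ?_, fun h x => rfl⟩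
  by_contra hh
  obtain ⟨x, hx⟩ := K.exists_smul_ne hh
  refine hx ?_
  change ((f h : flowCentralizer G K.X) : K.X ≃ₜ K.X) x = x
  rw [hf]
  rfl

end Construction

theorem mainTheorem2 (G H : Type*) [Group G] [Group H] [Countable G] [Infinite G]
    [Countable H] [Infinite H] :
    (∀ C : ℕ → Set H, IsExhaustion C → ∃ K : Construction G H, K.C = C) ∧
    ∀ K : Construction G H,
      (∀ n, IsSubshift (K.Y n) ∧ IsStronglyIrreducible (K.Y n)) ∧
      (∀ m n, m ≤ n → window (K.A n) (K.A m) 1 '' K.Y n = K.Y m) ∧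
      IsSubshift (K.X : Set (FullShift (G × H) Bool)) ∧
      IsEssentiallyFreeFlow H K.X ∧
      IsFreeFlow H K.X ∧
      IsMinimalFlow G K.X ∧
      ∃ f : H →* flowCentralizer G K.X, Function.Injective f ∧
        ∀ (h : H) (x : K.X), (f h : K.X ≃ₜ K.X) x = h • x :=
  ⟨fun _ hC => exists_construction hC, fun K =>
    ⟨fun n => ⟨⟨K.Y_nonempty n, K.isClosed_Y n, K.smul_mem_Y n⟩,
      K.D n, K.finite_D n, K.irreducible n n le_rfl⟩,
    fun _ _ h => K.window_image_Y h, K.isSubshift_X, K.isEssentiallyFreeFlow_H, K.isFreeFlow_H,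
    K.isMinimalFlow_G, K.exists_embedding_centralizer⟩⟩
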